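/- Let $\mathbb F_q$ be a finite field with $q$ elements, $A=\mathbb F_q[\theta]$, $K=\mathbb F_q(\theta)$, and let $\mathbb C_\infty$ be the completion of an algebraic closure of the completion $K_\infty$ of $K$ at the place $1/\theta$. Let $s\ge 2q-1$ be an integer with $s\equiv 1\pmod{q-1}$, let $m=\frac{s-1}{q-1}$ and $\mu=\frac{q^m-1}{q-1}-m$, and let $\mathbb T_s$ be the Tate algebra of power series in $t_1,\dots,t_s$ over $\mathbb C_\infty$ whose coefficients tend to $0$, with the Gauss norm. Write $A^+(d)$ for the set of monic polynomials of degree $d$ in $A$ and put $$S_d(1;s)=\sum_{a\in A^+(d)}\frac{a(t_1)\cdots a(t_s)}{a},\qquad F_d(1;s)=\sum_{i=0}^{d-1}S_i(1;s),\qquad \zeta_A(1;s)=\lim_{d\to\infty}F_d(1;s)\in\mathbb T_s ,$$ $$l_d=\prod_{i=1}^{d}(\theta-\theta^{q^i}),\qquad b_d(t)=\prod_{i=0}^{d-1}(t-\theta^{q^i}),\qquad \Pi_{s,d}=\frac{b_{d-m}(t_1)\cdots b_{d-m}(t_s)}{l_{d-1}}\quad(d\ge m).$$ Fix a root $(-\theta)^{1/(q-1)}\in\mathbb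 C_\infty$, and let $$\omega(t)=(-\theta)^{\frac1{q-1}}\prod_{i\ge0}\Bigl(1-\frac{t}{\theta^{q^i}}\Bigr)^{-1},\qquad \widetilde\pi=\theta(-\theta)^{\frac1{q-1}}\prod_{i\ge1}\Bigl(1-\frac{\theta}{\theta^{q^i}}\Bigr)^{-1}$$ be the Anderson-Thakur function and the fundamental period of the Carlitz exponential. Then there is a unique $\lambda_{1,s}\in A[t_1,\dots,t_s]$ with $$\zeta_A(1;s)=\frac{\widetilde\pi\,\lambda_{1,s}}{\omega(t_1)\cdots\omega(t_s)},$$ there is a unique polynomial $\mathbb H_s\in A[t_1,\dots,t_s][Y]$ with $F_d(1;s)=\Pi_{s,d}\,\mathbb H_s|_{Y=\theta^{q^{d-m}}}$ for all $d\ge m$, and $\mathbb H_s=\sum_{i=0}^{\mu}\mathbb D_iY^i$ has degree $\mu$ in $Y$. The series $\sum_i S_i(1;s)$ converges in $\mathbb T_s$, and there exists a polynomial $\nu_{1,s}\in A[t_1,\dots,t_s]$ such that, in $\mathbb T_s$, $$\lim_{d\to\infty}\theta^{q^{d-m}}\sum_{i\ge d}S_i(1;s)=\frac{\widetilde\pi\,\nu_{1,s}}{\omega(t_1)\cdots\omega(t_s)},$$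 and $$\mathbb D_{\mu-1}=\nu_{1,s}+(t_1+\cdots+t_s)\,\lambda_{1,s}.$$ -/

import Mathlib

open Filter Topology

noncomputable section

namespace CarlitzTate

open scoped NNReal
open MonoidWithZeroHom

/-! ### The field of coefficients

`F` is the finite field with `q = Fintype.card F` elements, `A = F[θ]` is `Polynomial F`, with
`θ = Polynomial.X`, and `K = F(θ)` is `RatFunc F`. -/

section Coefficients

variable (F : Type*) [Field F] [Fintype F]

/-- The completion of `K = F(θ)` at the infinite place. -/
abbrev KInfty : Type _ := @RatFunc.CompletionAtInfty F _ (Classical.decEq _)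

/-- The valuation at infinity gives the absolute value on `KInfty F` with `|θ| = q`. -/
instance KInfty.rankOne :
    Valuation.RankOne (Valued.v (R := KInfty F) (Γ₀ := WithZero (Multiplicative ℤ))) where
  hom' := (WithZeroMulInt.toNNReal (e := (Fintype.card F : ℝ≥0)) (by simp)).comp
    ValueGroup₀.embedding
  strictMono' := (WithZeroMulInt.toNNReal_strictMono
    (by exact_mod_cast Fintype.one_lt_card)).comp ValueGroup₀.embedding_strictMono
  exists_val_nontrivial := by
    classical
    refine ⟨algebraMap (RatFunc F) (KInfty F) RatFunc.X, ?_⟩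
    have h : Valued.v (algebraMap (RatFunc F) (KInfty F) RatFunc.X) = WithZero.exp (1 : ℤ) := by
      let _ := @RatFunc.inftyValued F _ (Classical.decEq _)
      refine (Valued.extensionValuation_apply_coe (K := RatFunc F) RatFunc.X).trans ?_
      exact @RatFunc.inftyValuation.X F _ (Classical.decEq _)
    rw [h]
    simp

instance KInfty.nontriviallyNormedField : NontriviallyNormedField (KInfty F) :=
  Valued.toNontriviallyNormedField (KInfty F) (WithZero (Multiplicative ℤ))

instance KInfty.completeSpace : CompleteSpace (KInfty F) := by
  let _ := @RatFunc.inftyValued F _ (Classical.decEq _)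
  exact inferInstanceAs (CompleteSpace (UniformSpace.Completion (RatFunc F)))

/-- An algebraic closure of `KInfty F`. -/
abbrev KInftyAlg : Type _ := AlgebraicClosure (KInfty F)

/-- The unique extension of the absolute value of `KInfty F` to its algebraic closure. -/
instance KInftyAlg.normedField : NormedField (KInftyAlg F) :=
  spectralNorm.normedField (KInfty F) (KInftyAlg F)

instance KInftyAlg.isUltrametricDist : IsUltrametricDist (KInftyAlg F) :=
  IsUltrametricDist.isUltrametricDist_of_forall_norm_add_le_max_norm
    (isNonarchimedean_spectralNorm (K := KInfty F) (L := KInftyAlg F))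

/-- The field `ℂ_∞`: the completion of an algebraic closure of `KInfty F`. -/
abbrev CInfty : Type _ := UniformSpace.Completion (KInftyAlg F)

instance CInfty.isUltrametricDist : IsUltrametricDist (CInfty F) :=
  IsUltrametricDist.of_normedAlgebra (KInftyAlg F)

/-- The embedding of `K = F(θ)` into `ℂ_∞`. -/
def ofK : RatFunc F →+* CInfty F :=
  (algebraMap (KInftyAlg F) (CInfty F)).comp
    ((algebraMap (KInfty F) (KInftyAlg F)).comp (algebraMap (RatFunc F) (KInfty F)))

/-- The element `θ` of `ℂ_∞`. -/
def theta : CInfty F := ofK F RatFunc.X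

end Coefficients

/-! ### The Tate algebra -/

section Tate

variable (F : Type*) [Field F] [Fintype F] (s : ℕ)

/-- The Tate algebra `𝕋_s`: the formal power series in `t_1, …, t_s` over `ℂ_∞` whose coefficients
tend to zero. -/
def Tate : Type _ :=
  MvPowerSeries.IsRestricted.subring (R := CInfty F) (σ := Fin s) (fun _ => 1)

instance Tate.commRing : CommRing (Tate F s) :=
  inferInstanceAs (CommRing
    (MvPowerSeries.IsRestricted.subring (R := CInfty F) (σ := Fin s) (fun _ => 1)))

variable {F s}

/-- The underlying power series. -/
def Tate.toSeries (f : Tate F s) : MvPowerSeries (Fin s) (CInfty F) := f.1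

/-- The Gauss norm: the supremum of the absolute values of the coefficients. -/
instance Tate.norm : Norm (Tate F s) :=
  ⟨fun f => MvPowerSeries.gaussNorm (fun x : CInfty F => ‖x‖) (fun _ => 1) f.toSeries⟩

theorem Tate.norm_eq (f : Tate F s) : ‖f‖ = ⨆ n, ‖MvPowerSeries.coeff n f.toSeries‖ := by
  simp [Norm.norm, MvPowerSeries.gaussNorm]

theorem Tate.hasGaussNorm (f : Tate F s) :
    MvPowerSeries.HasGaussNorm (fun x : CInfty F => ‖x‖) (fun _ => 1) f.toSeries := by
  have h : Tendsto _ cofinite (𝓝 (0 : ℝ)) := f.2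
  exact h.bddAbove_range_of_cofinite

variable (F s)

/-- The Tate algebra is a normed ring for the Gauss norm. -/
instance Tate.normedCommRing : NormedCommRing (Tate F s) :=
  { Tate.commRing F s, Tate.norm with
    dist := fun f g => ‖f - g‖
    dist_eq := fun f g => by
      have h : -f + g = -(f - g) := by ring
      rw [h]
      exact (MvPowerSeries.gaussNorm_neg (fun x : CInfty F => ‖x‖) (fun _ => 1)
        norm_neg (f - g).toSeries).symm
    dist_self := fun f => by
      rw [sub_self]
      exact MvPowerSeries.gaussNorm_zero _ _ norm_zero
    dist_comm := fun f g => by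
      rw [← neg_sub g f]
      exact MvPowerSeries.gaussNorm_neg (fun x : CInfty F => ‖x‖) (fun _ => 1)
        norm_neg (g - f).toSeries
    dist_triangle := fun f g h => by
      rw [← sub_add_sub_cancel f g h]
      refine (MvPowerSeries.gaussNorm_add_le_max (fun x : CInfty F => ‖x‖) (fun _ => 1)
        (f - g).toSeries (g - h).toSeries (fun _ => zero_le_one) (fun _ => norm_nonneg _)
        IsUltrametricDist.norm_add_le_max (f - g).hasGaussNorm (g - h).hasGaussNorm).trans ?_
      exact max_le_add_of_nonneg
        (MvPowerSeries.gaussNorm_nonneg _ _ _ (fun _ => norm_nonneg _))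
        (MvPowerSeries.gaussNorm_nonneg _ _ _ (fun _ => norm_nonneg _))
    eq_of_dist_eq_zero := fun {f g} h => by
      have h' := (MvPowerSeries.gaussNorm_eq_zero_iff (fun x : CInfty F => ‖x‖) (fun _ => 1)
        (f - g).toSeries norm_zero (fun _ => norm_nonneg _) (fun _ => norm_eq_zero.1)
        (fun _ => zero_lt_one) (f - g).hasGaussNorm).1 h
      exact sub_eq_zero.1 (Subtype.ext h')
    norm_mul_le := fun f g =>
      MvPowerSeries.gaussNorm_mul_le (fun x : CInfty F => ‖x‖) (fun _ => 1)
        f.toSeries g.toSeries (fun _ => zero_le_one) (fun _ => norm_nonneg _) norm_mul_le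
        IsUltrametricDist.norm_add_le_max norm_zero f.hasGaussNorm g.hasGaussNorm }

/-- A polynomial in `t_1, …, t_s` over `ℂ_∞`, as an element of the Tate algebra. -/
def Tate.ofPoly : MvPolynomial (Fin s) (CInfty F) →+* Tate F s :=
  (MvPolynomial.coeToMvPowerSeries.ringHom).codRestrict
    (MvPowerSeries.IsRestricted.subring (R := CInfty F) (σ := Fin s) (fun _ => 1))
    (fun p => by
      refine tendsto_nhds_of_eventually_eq (p.support.finite_toSet.subset ?_)
      intro n hn
      by_contra h
      refine hn ?_
      have h0 : MvPolynomial.coeff n p = 0 := by simpa using h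
      simp [h0])

/-- Constants. -/
def Tate.const : CInfty F →+* Tate F s := (Tate.ofPoly F s).comp MvPolynomial.C

/-- The embedding of `K[t_1, …, t_s]`. -/
def Tate.ofKPoly : MvPolynomial (Fin s) (RatFunc F) →+* Tate F s :=
  (Tate.ofPoly F s).comp (MvPolynomial.map (ofK F))

end Tate

/-- The embedding of `A[t_1, …, t_s]` into `K[t_1, …, t_s]`. -/
def polyAToK (F : Type*) [Field F] (s : ℕ) :
    MvPolynomial (Fin s) (Polynomial F) →+* MvPolynomial (Fin s) (RatFunc F) :=
  MvPolynomial.map (algebraMap (Polynomial F) (RatFunc F))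

/-! ### The Anderson-Thakur function and the period of the Carlitz exponential -/

section Periods

variable {F : Type*} [Field F] [Fintype F]

/-- The value `ω(t_j)` of the Anderson-Thakur function
`ω(t) = ϖ ∏_{i ≥ 0} (1 - t / θ^(q^i))⁻¹`, where `ϖ` is the chosen `(q-1)`-th root of `-θ`. -/
def omega {s : ℕ} (ϖ : CInfty F) (j : Fin s) : Tate F s :=
  Tate.const F s ϖ * ∏' i : ℕ, Ring.inverse
    (1 - Tate.ofPoly F s (MvPolynomial.X j) *
      Tate.const F s ((theta F ^ (Fintype.card F ^ i))⁻¹))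

/-- The fundamental period of the Carlitz exponential,
`θ ϖ ∏_{i ≥ 1} (1 - θ / θ^(q^i))⁻¹`, where `ϖ` is the chosen `(q-1)`-th root of `-θ`. -/
def piTilde (ϖ : CInfty F) : CInfty F :=
  theta F * ϖ * ∏' i : ℕ, (1 - theta F / theta F ^ (Fintype.card F ^ (i + 1)))⁻¹

/-- The element `π̃ ν / (ω(t_1) ⋯ ω(t_s))` of the Tate algebra, for `ν ∈ A[t_1, …, t_s]`. -/
def periodMultiple {s : ℕ} (ϖ : CInfty F) (ν : MvPolynomial (Fin s) (Polynomial F)) : Tate F s :=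
  Tate.const F s (piTilde ϖ) * Tate.ofKPoly F s (polyAToK F s ν) *
    Ring.inverse (∏ j : Fin s, omega ϖ j)

end Periods

/-! ### Twisted power sums and harmonic sums -/

section Sums

variable (F : Type*) [Field F] [Fintype F]

/-- The set `A⁺(d)` of monic polynomials of degree `d`. -/
def monics (d : ℕ) : Finset (Polynomial F) :=
  letI := Classical.decEq (Polynomial F)
  letI := Classical.decEq F
  (Finset.univ : Finset (Fin d → F)).image
    (fun c => Polynomial.X ^ d + ∑ i : Fin d, Polynomial.C (c i) * Polynomial.X ^ (i : ℕ))

theorem mem_monics {d : ℕ} {a : Polynomial F} :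
    a ∈ monics F d ↔ a.Monic ∧ a.natDegree = d := by
  classical
  simp only [monics, Finset.mem_image, Finset.mem_univ, true_and]
  constructor
  · rintro ⟨c, rfl⟩
    have h : (∑ i : Fin d, Polynomial.C (c i) * Polynomial.X ^ (i : ℕ)).degree
        < (d : WithBot ℕ) := Polynomial.degree_sum_fin_lt c
    refine ⟨Polynomial.monic_X_pow_add h, ?_⟩
    rw [Polynomial.natDegree_add_eq_left_of_degree_lt, Polynomial.natDegree_X_pow]
    rwa [Polynomial.degree_X_pow]
  · rintro ⟨h1, rfl⟩
    refine ⟨fun i => a.coeff i, ?_⟩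
    conv_rhs => rw [h1.as_sum]
    rw [Fin.sum_univ_eq_sum_range
      (fun i => Polynomial.C (a.coeff i) * (Polynomial.X : Polynomial F) ^ i) a.natDegree]

variable (s : ℕ)

/-- The twisted power sum `S_d(n;s) = ∑_{a ∈ A⁺(d)} a(t_1) ⋯ a(t_s) / a^n`. -/
def powerSum (n : ℤ) (d : ℕ) : MvPolynomial (Fin s) (RatFunc F) :=
  ∑ a ∈ monics F d,
    MvPolynomial.C ((algebraMap (Polynomial F) (RatFunc F) a) ^ (-n)) *
      ∏ j : Fin s, Polynomial.aeval (MvPolynomial.X j : MvPolynomial (Fin s) (RatFunc F)) a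

/-- The twisted harmonic sum `F_d(n;s) = ∑_{i < d} S_i(n;s)`. -/
def harmonicSum (n : ℤ) (d : ℕ) : MvPolynomial (Fin s) (RatFunc F) :=
  ∑ i ∈ Finset.range d, powerSum F s n i

/-- `l_d = (θ - θ^q) ⋯ (θ - θ^(q^d))`. -/
def carlitzL (d : ℕ) : Polynomial F :=
  ∏ i ∈ Finset.range d,
    (Polynomial.X - Polynomial.X ^ (Fintype.card F ^ (i + 1)))

variable {s}

/-- `b_i(t_j) = (t_j - θ)(t_j - θ^q) ⋯ (t_j - θ^(q^(i-1)))`. -/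
def carlitzB (i : ℕ) (j : Fin s) : MvPolynomial (Fin s) (Polynomial F) :=
  ∏ k ∈ Finset.range i,
    (MvPolynomial.X j - MvPolynomial.C (Polynomial.X ^ (Fintype.card F ^ k)))

variable (s)

/-- `m = ⌊(s - 1) / (q - 1)⌋`. -/
def mIndex : ℕ := (s - 1) / (Fintype.card F - 1)

/-- `μ = (q^m - 1) / (q - 1) - m`. -/
def muIndex : ℕ := (Fintype.card F ^ mIndex F s - 1) / (Fintype.card F - 1) - mIndex F s

/-- `Π_{s,d} = b_{d-m}(t_1) ⋯ b_{d-m}(t_s) / l_{d-1}`. -/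
def bigPi (d : ℕ) : MvPolynomial (Fin s) (RatFunc F) :=
  MvPolynomial.C ((algebraMap (Polynomial F) (RatFunc F) (carlitzL F (d - 1)))⁻¹) *
    ∏ j : Fin s, polyAToK F s (carlitzB F (d - mIndex F s) j)

variable {F s}

/-- `H ∈ A[t_1, …, t_s][Y]` interpolates the twisted harmonic sums:
`F_d(1;s) = Π_{s,d} H(θ^(q^(d-m)))` for all `d ≥ m`. -/
def Interpolates (H : Polynomial (MvPolynomial (Fin s) (Polynomial F))) : Prop :=
  ∀ d : ℕ, mIndex F s ≤ d →
    harmonicSum F s 1 d = bigPi F s d * polyAToK F s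
      (H.eval (MvPolynomial.C (Polynomial.X ^ (Fintype.card F ^ (d - mIndex F s)))))

/-- `ζ_A(1;s) = lim_d F_d(1;s) = π̃ lam / (ω(t_1) ⋯ ω(t_s))` in the Tate algebra. -/
def IsZetaCoefficient (ϖ : CInfty F) (lam : MvPolynomial (Fin s) (Polynomial F)) : Prop :=
  Tendsto (fun d : ℕ => Tate.ofKPoly F s (harmonicSum F s 1 d)) atTop
    (𝓝 (periodMultiple ϖ lam))

end Sums

end CarlitzTate

end

/-! Write Δ_k(a) for `newtonCoeff F k a`, so that a(t) = Σ_k Δ_k(a) b_k(t), and [k] = θ^(q^k) - θ.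
The algebra rests on the Artin-Schreier relation Δ_k(a)^q - Δ_k(a) = [k+1] Δ_{k+1}(a)
(`newtonCoeff_pow_card`).

Interpolation. Since s ≡ 1 mod q-1, F_d is minus the sum of a(t_1)⋯a(t_s)/a over all nonzero a of
degree < d (`sum_twistedTerm`). Put d = n + m and divide each a(t_j) by b_n(t_j). For k < n,
Δ_k(a)/a is a combination of powers a^(q^i - 1) with i ≤ k, so every term that involves a remainder
is a combination of sums over F^d of products of fewer than (q-1)d linear forms, and these vanish as
in Chevalley-Warning (`harmonicSum_eq_prod_carlitzB_mul`). The quotients see only the top m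
coefficients v of a, and summing 1/a over the others gives 1/(l_n Δ_n(θ^n v)), whose denominator
divides l_{d-1} (`exists_harmonicSum_eq_bigPi_mul`). What remains is a sum over v of a function of
Δ_n(θ^n v). These q^m elements are the roots of an additive polynomial whose coefficients are
polynomials in θ and Y = θ^(q^n), so the sum is P(Y)/Q(Y) with P, Q independent of n and Q monic
(`interpDenom_mul_eq_interpNumer`). All these values are integral, and comparing degrees in θ forces
Q ∣ P (`eq_zero_of_forall_eval_dvd`); the quotient is H.

Asymptotics. The products U_n = Π_{s,d} θ^(μ q^n) are partial products of a unit U (`periodFactor`)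
with π̃ν/∏ω(t_j) = -Uν. As F_d tends to ζ ≠ 0, the degree of H must be μ and ζ = U 𝔻_μ, that is λ =
-𝔻_μ. To the next order, θ^(q^n)(U/U_n - 1) tends to -Σ t_j and θ^(q^n)(H(Y)/Y^μ - 𝔻_μ) tends to
𝔻_{μ-1}. Therefore θ^(q^n)(ζ - F_d) tends to -U(𝔻_{μ-1} + (Σ t_j) 𝔻_μ), which is the assertion with
ν = 𝔻_{μ-1} + (Σ t_j) 𝔻_μ. -/

set_option linter.unusedSectionVars false

noncomputable section

namespace CarlitzTate

open Polynomial

section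

variable {F : Type*} [Field F] [Fintype F]

/-! ### Newton expansion at the points `θ, θ^q, θ^(q^2), …` -/

variable (F) in
/-- The coefficient of `b_k` in the Newton expansion of `t^r` at `θ, θ^q, θ^(q^2), …`. -/
def newtonMonomial : ℕ → ℕ → F[X]
  | 0, 0 => 1
  | _ + 1, 0 => 0
  | 0, r + 1 => X * newtonMonomial 0 r
  | k + 1, r + 1 => X ^ (Fintype.card F ^ (k + 1)) * newtonMonomial (k + 1) r + newtonMonomial k r

variable (F) in
/-- The coefficient of `b_k` in the Newton expansion of `a(t)`. -/
def newtonCoeff (k : ℕ) : F[X] →ₗ[F] F[X] :=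
  Polynomial.lsum fun r => LinearMap.toSpanSingleton F F[X] (newtonMonomial F k r)

theorem newtonCoeff_monomial (k r : ℕ) (c : F) :
    newtonCoeff F k (monomial r c) = c • newtonMonomial F k r := by
  simp [newtonCoeff, Polynomial.sum_monomial_index]

theorem newtonCoeff_zero_apply (a : F[X]) : newtonCoeff F 0 a = a := by
  have h : ∀ r, newtonMonomial F 0 r = X ^ r := by
    intro r
    induction r with
    | zero => simp [newtonMonomial]
    | succ r ih => rw [newtonMonomial, ih, pow_succ']
  induction a using Polynomial.induction_on' with
  | add p q hp hq => rw [map_add, hp, hq]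
  | monomial r c => rw [newtonCoeff_monomial, h, smul_X_eq_monomial]

theorem newtonCoeff_succ_X_mul (k : ℕ) (a : F[X]) :
    newtonCoeff F (k + 1) (X * a) =
      X ^ (Fintype.card F ^ (k + 1)) * newtonCoeff F (k + 1) a + newtonCoeff F k a := by
  induction a using Polynomial.induction_on' with
  | add p q hp hq => rw [mul_add, map_add, hp, hq, map_add, map_add]; ring
  | monomial r c =>
    rw [X_mul_monomial, newtonCoeff_monomial, newtonCoeff_monomial, newtonCoeff_monomial,
      newtonMonomial, smul_add, mul_smul_comm]

theorem newtonMonomial_of_lt {k r : ℕ} (h : r < k) : newtonMonomial F k r = 0 := by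
  induction r generalizing k with
  | zero =>
    obtain ⟨k, rfl⟩ := Nat.exists_eq_succ_of_ne_zero h.ne'
    rfl
  | succ r ih =>
    obtain ⟨k, rfl⟩ := Nat.exists_eq_succ_of_ne_zero (by omega : k ≠ 0)
    rw [Nat.succ_eq_add_one, newtonMonomial, ih (by omega), ih (by omega), mul_zero, add_zero]

theorem newtonMonomial_self (r : ℕ) : newtonMonomial F r r = 1 := by
  induction r with
  | zero => rfl
  | succ r ih => rw [newtonMonomial, newtonMonomial_of_lt (by omega), ih, mul_zero, zero_add]

theorem newtonCoeff_eq_sum (k : ℕ) (a : F[X]) :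
    newtonCoeff F k a = ∑ r ∈ a.support, a.coeff r • newtonMonomial F k r := by
  conv_lhs => rw [a.as_sum_support, map_sum]
  simp only [newtonCoeff_monomial]

theorem newtonCoeff_of_degree_lt {k : ℕ} {a : F[X]} (h : a.degree < k) :
    newtonCoeff F k a = 0 := by
  rw [newtonCoeff_eq_sum]
  refine Finset.sum_eq_zero fun r hr => ?_
  have h1 : (r : WithBot ℕ) < k := (le_degree_of_mem_supp r hr).trans_lt h
  rw [newtonMonomial_of_lt (by exact_mod_cast h1), smul_zero]

theorem newtonCoeff_natDegree (a : F[X]) :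
    newtonCoeff F a.natDegree a = C a.leadingCoeff := by
  rw [newtonCoeff_eq_sum, Finset.sum_eq_single a.natDegree]
  · rw [newtonMonomial_self, leadingCoeff, smul_eq_C_mul, mul_one]
  · intro r hr hne
    have := le_natDegree_of_mem_supp r hr
    rw [newtonMonomial_of_lt (by omega), smul_zero]
  · intro h
    rw [notMem_support_iff.1 h, zero_smul]

variable (F) in
/-- `[k] = θ^(q^k) - θ`. -/
def bracket (k : ℕ) : F[X] := X ^ (Fintype.card F ^ k) - X

theorem bracket_monic {k : ℕ} (hk : k ≠ 0) : (bracket F k).Monic :=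
  monic_X_pow_sub (by
    rw [degree_X]
    exact_mod_cast Nat.one_lt_pow hk Fintype.one_lt_card)

theorem bracket_ne_zero {k : ℕ} (hk : k ≠ 0) : bracket F k ≠ 0 := (bracket_monic hk).ne_zero

/-- Both sides are F-linear in `a`, because the q-power map fixes `F`; powers of `X` follow by
induction from the Newton recursion. All later facts about Newton coefficients (integrality,
divisibility, expression in powers of `a`) are read off from this relation. -/
theorem newtonCoeff_pow_card (k : ℕ) (a : F[X]) :
    newtonCoeff F k a ^ Fintype.card F =
      newtonCoeff F k a + bracket F (k + 1) * newtonCoeff F (k + 1) a := by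
  have key : ∀ r k, newtonCoeff F k (X ^ r) ^ Fintype.card F =
      newtonCoeff F k (X ^ r) + bracket F (k + 1) * newtonCoeff F (k + 1) (X ^ r) := by
    intro r
    induction r with
    | zero =>
      intro k
      have hq : Fintype.card F ≠ 0 := Fintype.card_ne_zero
      have h1 : ∀ k, newtonCoeff F (k + 1) ((X : F[X]) ^ 0) = 0 := fun k =>
        newtonCoeff_of_degree_lt (by rw [pow_zero, degree_one]; exact_mod_cast Nat.succ_pos k)
      rw [h1, mul_zero, add_zero]
      cases k with
      | zero => rw [newtonCoeff_zero_apply]; simp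
      | succ k => rw [h1, zero_pow hq]
    | succ r ih =>
      intro k
      have h0 : newtonCoeff F 0 ((X : F[X]) ^ r) = X ^ r := newtonCoeff_zero_apply _
      have hq : ∀ a b : F[X], (a + b) ^ Fintype.card F = a ^ Fintype.card F + b ^ Fintype.card F :=
        fun a b => map_add (FiniteField.frobeniusAlgHom F F[X]) a b
      rw [pow_succ', newtonCoeff_succ_X_mul]
      cases k with
      | zero =>
        have h := ih 0
        simp only [newtonCoeff_zero_apply] at h ⊢
        rw [mul_pow, h]
        simp only [bracket, zero_add, pow_one]
        ring
      | succ k =>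
        rw [newtonCoeff_succ_X_mul, hq, mul_pow, ih, ih, ← pow_mul, ← pow_succ]
        simp only [bracket]
        ring
  induction a using Polynomial.induction_on' with
  | add a b ha hb =>
    have hq : ∀ a b : F[X], (a + b) ^ Fintype.card F = a ^ Fintype.card F + b ^ Fintype.card F :=
        fun a b => map_add (FiniteField.frobeniusAlgHom F F[X]) a b
    rw [map_add, map_add, hq, ha, hb]
    ring
  | monomial r c =>
    rw [← smul_X_eq_monomial, map_smul, map_smul, _root_.smul_pow, FiniteField.pow_card, key,
      smul_add, mul_smul_comm]

theorem aeval_X_eq_sum_newtonCoeff {s d : ℕ} (j : Fin s) {a : F[X]} (h : a.degree < d) :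
    aeval (MvPolynomial.X j : MvPolynomial (Fin s) F[X]) a =
      ∑ k ∈ Finset.range d, MvPolynomial.C (newtonCoeff F k a) * carlitzB F k j := by
  have key : ∀ r, ∀ d, r < d → (MvPolynomial.X j : MvPolynomial (Fin s) F[X]) ^ r =
      ∑ k ∈ Finset.range d, MvPolynomial.C (newtonMonomial F k r) * carlitzB F k j := by
    intro r
    induction r with
    | zero =>
      intro d hd
      rw [Finset.sum_eq_single_of_mem 0 (Finset.mem_range.2 hd)]
      · simp [newtonMonomial, carlitzB]
      · intro k _ hk
        rw [newtonMonomial_of_lt (by omega), map_zero, zero_mul]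
    | succ r ih =>
      intro d hd
      obtain ⟨d, rfl⟩ := Nat.exists_eq_succ_of_ne_zero (by omega : d ≠ 0)
      -- This relation is what turns the recursion defining `newtonMonomial` into multiplication by
      -- t_j.
      have hB : ∀ k, (MvPolynomial.X j : MvPolynomial (Fin s) F[X]) * carlitzB F k j =
          carlitzB F (k + 1) j + MvPolynomial.C (X ^ Fintype.card F ^ k) * carlitzB F k j := by
        intro k
        rw [carlitzB, carlitzB, Finset.prod_range_succ]
        ring
      rw [pow_succ', ih (d + 1) (by omega), Finset.mul_sum]
      have h1 : ∀ k, (MvPolynomial.X j : MvPolynomial (Fin s) F[X]) *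
          (MvPolynomial.C (newtonMonomial F k r) * carlitzB F k j) =
          MvPolynomial.C (newtonMonomial F k r) * carlitzB F (k + 1) j +
          MvPolynomial.C (X ^ Fintype.card F ^ k * newtonMonomial F k r) * carlitzB F k j := by
        intro k
        rw [mul_left_comm, hB, map_mul]
        ring
      simp only [h1, Finset.sum_add_distrib]
      rw [Finset.sum_range_succ, newtonMonomial_of_lt (by omega : r < d), map_zero, zero_mul,
        add_zero, Finset.sum_range_succ', Finset.sum_range_succ' (n := d), ← add_assoc,
        ← Finset.sum_add_distrib]
      simp only [newtonMonomial, map_add, pow_zero, pow_one]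
      congr 1
      refine Finset.sum_congr rfl fun k _ => ?_
      ring
  rcases eq_or_ne a 0 with rfl | ha
  · simp
  rw [aeval_eq_sum_range' (n := d)]
  · have : ∀ k, newtonCoeff F k a =
        ∑ r ∈ Finset.range d, a.coeff r • newtonMonomial F k r := by
      intro k
      rw [newtonCoeff_eq_sum]
      refine Finset.sum_subset (fun r hr => ?_) (fun r _ hr => ?_)
      · have h1 : (r : WithBot ℕ) < d := (le_degree_of_mem_supp r hr).trans_lt h
        exact Finset.mem_range.2 (by exact_mod_cast h1)
      · rw [notMem_support_iff.1 hr, zero_smul]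
    simp only [this, map_sum, Finset.sum_mul]
    rw [Finset.sum_comm]
    refine Finset.sum_congr rfl fun r hr => ?_
    rw [key r d (Finset.mem_range.1 hr), Finset.smul_sum]
    refine Finset.sum_congr rfl fun k _ => ?_
    rw [smul_eq_C_mul, map_mul, Algebra.smul_def, mul_assoc]
    rfl
  · exact (natDegree_lt_iff_degree_lt ha).2 h

end

section

variable {F : Type*} [Field F] [Fintype F]

/-! ### Sums over polynomials of bounded degree -/

variable (F) in
/-- The polynomial with given coefficients. -/
def ofCoeffs (d : ℕ) : (Fin d → F) →ₗ[F] F[X] :=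
  ∑ i : Fin d, (monomial (i : ℕ)).comp (LinearMap.proj i)

theorem ofCoeffs_apply {d : ℕ} (c : Fin d → F) :
    ofCoeffs F d c = ∑ i : Fin d, monomial (i : ℕ) (c i) := by
  simp [ofCoeffs, LinearMap.sum_apply]

theorem ofCoeffs_eq {d : ℕ} (c : Fin d → F) :
    ofCoeffs F d c = ∑ i : Fin d, C (c i) * X ^ (i : ℕ) := by
  simp [ofCoeffs_apply, C_mul_X_pow_eq_monomial]

theorem degree_ofCoeffs_lt {d : ℕ} (c : Fin d → F) : (ofCoeffs F d c).degree < d := by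
  rw [ofCoeffs_eq]
  exact degree_sum_fin_lt c

theorem coeff_ofCoeffs {d : ℕ} (c : Fin d → F) (i : Fin d) : (ofCoeffs F d c).coeff i = c i := by
  simp [ofCoeffs_apply, finsetSum_coeff, coeff_monomial, Fin.val_inj]

theorem ofCoeffs_injective (d : ℕ) : Function.Injective (ofCoeffs F d) := fun c c' h => by
  funext i
  rw [← coeff_ofCoeffs c, h, coeff_ofCoeffs]

theorem ofCoeffs_snoc {d : ℕ} (c : Fin d → F) (x : F) :
    ofCoeffs F (d + 1) (Fin.snoc (α := fun _ => F) c x) = ofCoeffs F d c + monomial d x := by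
  simp [ofCoeffs_apply, Fin.sum_univ_castSucc]

theorem ofCoeffs_append {n m : ℕ} (w : Fin n → F) (v : Fin m → F) :
    ofCoeffs F (n + m) (Fin.append w v) = ofCoeffs F n w + X ^ n * ofCoeffs F m v := by
  simp [ofCoeffs_apply, Fin.sum_univ_add, Finset.mul_sum, X_pow_mul_monomial, add_comm]

theorem sum_snoc {d : ℕ} {M : Type*} [AddCommMonoid M] (f : (Fin (d + 1) → F) → M) :
    ∑ c, f c = ∑ x : F, ∑ c : Fin d → F, f (Fin.snoc (α := fun _ => F) c x) := by
  rw [← (Fin.snocEquiv fun _ : Fin (d + 1) => F).sum_comp f, Fintype.sum_prod_type]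
  rfl

theorem sum_append {n m : ℕ} {M : Type*} [AddCommMonoid M] (f : (Fin (n + m) → F) → M) :
    ∑ c, f c = ∑ v : Fin m → F, ∑ w : Fin n → F, f (Fin.append w v) := by
  rw [← (Fin.appendEquiv (α := F) n m).sum_comp f, Fintype.sum_prod_type_right]
  rfl

theorem sum_monics {M : Type*} [AddCommMonoid M] (d : ℕ) (f : F[X] → M) :
    ∑ a ∈ monics F d, f a = ∑ c : Fin d → F, f (X ^ d + ofCoeffs F d c) := by
  let _ := Classical.decEq F[X]
  rw [monics, Finset.sum_image]
  · refine Finset.sum_congr rfl fun c _ => ?_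
    rw [ofCoeffs_eq]
  · intro c _ c' _ h
    simp only [← ofCoeffs_eq] at h
    exact ofCoeffs_injective d (add_left_cancel h)

/-- A sum over the values of a polynomial of small degree at the points of `F^d` vanishes. -/
theorem sum_eval_algebraMap_eq_zero {R : Type*} [CommRing R] [Algebra F R] {d : ℕ}
    (f : MvPolynomial (Fin d) R) (h : f.totalDegree < (Fintype.card F - 1) * d) :
    ∑ x : Fin d → F, MvPolynomial.eval (fun i => algebraMap F R (x i)) f = 0 := by
  classical
  simp only [MvPolynomial.eval_eq']
  rw [Finset.sum_comm]
  refine Finset.sum_eq_zero fun e he => ?_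
  rw [← Finset.mul_sum]
  -- The coefficients lie in `R`, but on F^d each monomial takes values in the image of `F`, so the
  -- vanishing over `F` applies monomial by monomial.
  have h1 : (MvPolynomial.monomial e (1 : F)).totalDegree < (Fintype.card F - 1) *
      Fintype.card (Fin d) := by
    rw [Fintype.card_fin]
    refine lt_of_le_of_lt ?_ h
    rw [MvPolynomial.totalDegree_monomial e one_ne_zero]
    exact MvPolynomial.le_totalDegree he
  have h2 := MvPolynomial.sum_eval_eq_zero _ h1
  have h3 : ∑ x : Fin d → F, ∏ i, algebraMap F R (x i) ^ e i = 0 := by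
    rw [← map_zero (algebraMap F R), ← h2, map_sum]
    refine Finset.sum_congr rfl fun x _ => ?_
    rw [MvPolynomial.eval_monomial, one_mul, Finsupp.prod_fintype _ _ (fun _ => pow_zero _),
      map_prod]
    simp only [map_pow]
  rw [h3, mul_zero]

theorem sum_prod_linearMap_eq_zero {R ι : Type*} [CommRing R] [Algebra F R] {d : ℕ} (T : Finset ι)
    (ℓ : ι → (Fin d → F) →ₗ[F] R) (h : T.card < (Fintype.card F - 1) * d) :
    ∑ x : Fin d → F, ∏ r ∈ T, ℓ r x = 0 := by
  classical
  let f : MvPolynomial (Fin d) R :=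
    ∏ r ∈ T, ∑ i, MvPolynomial.C (ℓ r (Pi.single i 1)) * MvPolynomial.X i
  have hf : f.totalDegree ≤ T.card := by
    refine (MvPolynomial.totalDegree_finsetProd _ _).trans ?_
    rw [Finset.card_eq_sum_ones]
    refine Finset.sum_le_sum fun r _ => MvPolynomial.totalDegree_finsetSum_le fun i _ => ?_
    refine (MvPolynomial.totalDegree_mul _ _).trans ?_
    rw [MvPolynomial.totalDegree_C, zero_add]
    exact (MvPolynomial.totalDegree_monomial_le _ _).trans (by simp)
  rw [← sum_eval_algebraMap_eq_zero f (hf.trans_lt h)]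
  refine Finset.sum_congr rfl fun x _ => ?_
  simp only [f, map_prod, map_sum, map_mul, MvPolynomial.eval_C, MvPolynomial.eval_X]
  refine Finset.prod_congr rfl fun r _ => ?_
  conv_lhs => rw [pi_eq_sum_univ' x, map_sum]
  refine Finset.sum_congr rfl fun i _ => ?_
  rw [map_smul, Algebra.smul_def, mul_comm]

/-- Dividing the Artin-Schreier relation by [k+1] expresses Δ_{k+1} through Δ_k^q and Δ_k. The form
in powers a^(q^i) is what permits cancelling a factor 1/a. -/
theorem exists_newtonCoeff_eq_sum_pow (k : ℕ) : ∃ c : ℕ → RatFunc F, ∀ a : F[X],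
    algebraMap F[X] (RatFunc F) (newtonCoeff F k a) =
      ∑ i ∈ Finset.range (k + 1), c i * algebraMap F[X] (RatFunc F) a ^ (Fintype.card F ^ i) := by
  induction k with
  | zero => exact ⟨1, fun a => by simp [newtonCoeff_zero_apply]⟩
  | succ k ih =>
    obtain ⟨c, hc⟩ := ih
    have hb : algebraMap F[X] (RatFunc F) (bracket F (k + 1)) ≠ 0 := by
      simpa using bracket_ne_zero k.succ_ne_zero
    refine ⟨fun i => (algebraMap F[X] (RatFunc F) (bracket F (k + 1)))⁻¹ *
      ((if i = 0 then 0 else c (i - 1) ^ Fintype.card F) - if i = k + 1 then 0 else c i),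
      fun a => ?_⟩
    have h := congrArg (algebraMap F[X] (RatFunc F)) (newtonCoeff_pow_card k a)
    rw [map_add, map_mul, map_pow] at h
    have h' : algebraMap F[X] (RatFunc F) (newtonCoeff F (k + 1) a) =
        (algebraMap F[X] (RatFunc F) (bracket F (k + 1)))⁻¹ *
        (algebraMap F[X] (RatFunc F) (newtonCoeff F k a) ^ Fintype.card F -
          algebraMap F[X] (RatFunc F) (newtonCoeff F k a)) := by
      rw [h, add_sub_cancel_left, inv_mul_cancel_left₀ hb]
    have hq : ∀ f : ℕ → RatFunc F, (∑ i ∈ Finset.range (k + 1), f i) ^ Fintype.card F =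
        ∑ i ∈ Finset.range (k + 1), f i ^ Fintype.card F :=
      fun f => map_sum (FiniteField.frobeniusAlgHom F (RatFunc F)) _ _
    rw [h', hc, hq]
    simp only [mul_assoc, sub_mul, ← Finset.mul_sum, Finset.sum_sub_distrib]
    congr 2
    · rw [Finset.sum_range_succ' _ (k + 1)]
      simp only [Nat.add_eq_zero_iff, one_ne_zero, and_false, if_false, if_true, zero_mul, add_zero,
        Nat.add_sub_cancel, mul_pow, ← pow_mul, ← pow_succ]
    · rw [Finset.sum_range_succ _ (k + 1), if_pos rfl, zero_mul, add_zero]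
      refine Finset.sum_congr rfl fun i hi => ?_
      rw [if_neg (Finset.mem_range.1 hi).ne]

end

section

variable {F : Type*} [Field F] [Fintype F]

/-! ### The harmonic sums as sums over all polynomials of bounded degree -/

variable (F) in
/-- The term `a(t_1) ⋯ a(t_s) / a` of the twisted power sums. -/
def twistedTerm (s : ℕ) (a : F[X]) : MvPolynomial (Fin s) (RatFunc F) :=
  MvPolynomial.C (algebraMap F[X] (RatFunc F) a)⁻¹ *
    ∏ j : Fin s, aeval (MvPolynomial.X j : MvPolynomial (Fin s) (RatFunc F)) a

theorem powerSum_one (s d : ℕ) : powerSum F s 1 d = ∑ a ∈ monics F d, twistedTerm F s a := by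
  simp only [powerSum, twistedTerm, zpow_neg_one]

theorem twistedTerm_zero (s : ℕ) : twistedTerm F s 0 = 0 := by
  simp [twistedTerm]

theorem twistedTerm_smul {s : ℕ} (hs : Fintype.card F - 1 ∣ s - 1) (h0 : s ≠ 0) {x : F}
    (hx : x ≠ 0) (a : F[X]) : twistedTerm F s (x • a) = twistedTerm F s a := by
  have h1 : x⁻¹ * x ^ s = 1 := by
    obtain ⟨k, hk⟩ := hs
    obtain ⟨t, rfl⟩ := Nat.exists_eq_succ_of_ne_zero h0
    have : t = (Fintype.card F - 1) * k := hk
    rw [Nat.succ_eq_add_one, pow_succ', inv_mul_cancel_left₀ hx, this, pow_mul,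
      FiniteField.pow_card_sub_one_eq_one x hx, one_pow]
  have h2 : algebraMap F[X] (RatFunc F) (x • a) =
      algebraMap F (RatFunc F) x * algebraMap F[X] (RatFunc F) a := by
    rw [Algebra.smul_def, map_mul, ← IsScalarTower.algebraMap_apply]
  have h3 : (MvPolynomial.C (algebraMap F (RatFunc F) x)⁻¹ : MvPolynomial (Fin s) (RatFunc F)) *
      (algebraMap F (MvPolynomial (Fin s) (RatFunc F)) x) ^ s = 1 := by
    have : algebraMap F (MvPolynomial (Fin s) (RatFunc F)) x =
        MvPolynomial.C (algebraMap F (RatFunc F) x) := rfl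
    rw [this, ← map_pow, ← map_mul, ← map_inv₀, ← map_pow, ← map_mul, h1, map_one, map_one]
  simp only [twistedTerm]
  rw [h2, mul_inv, map_mul]
  simp only [map_smul]
  simp only [Algebra.smul_def (R := F), Finset.prod_mul_distrib, Finset.prod_const,
    Finset.card_univ, Fintype.card_fin]
  rw [mul_mul_mul_comm, h3, one_mul]

/-- Terms depend only on `a` up to scalars in F^×, since x^(s-1) = 1, and the q - 1 possible leading
coefficients count as -1 in `F`. Working with a full vector space of polynomials makes vanishing
arguments over F^d available. -/
theorem sum_twistedTerm {s : ℕ} (hs : Fintype.card F - 1 ∣ s - 1) (h0 : s ≠ 0) (d : ℕ) :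
    ∑ c : Fin d → F, twistedTerm F s (ofCoeffs F d c) = -harmonicSum F s 1 d := by
  classical
  induction d with
  | zero => simp [harmonicSum, ofCoeffs_apply, twistedTerm_zero]
  | succ d ih =>
    rw [sum_snoc, ← Finset.add_sum_erase _ _ (Finset.mem_univ (0 : F))]
    simp only [ofCoeffs_snoc, map_zero, add_zero]
    rw [ih, harmonicSum, harmonicSum, Finset.sum_range_succ, neg_add, powerSum_one, sum_monics]
    congr 1
    have h1 : ∀ x ∈ (Finset.univ : Finset F).erase 0,
        ∑ c : Fin d → F, twistedTerm F s (ofCoeffs F d c + monomial d x) =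
        ∑ c : Fin d → F, twistedTerm F s (X ^ d + ofCoeffs F d c) := by
      intro x hx
      have hx0 : x ≠ 0 := Finset.ne_of_mem_erase hx
      rw [← (Equiv.smulRight hx0 : (Fin d → F) ≃ (Fin d → F)).sum_comp]
      refine Finset.sum_congr rfl fun c _ => ?_
      rw [← twistedTerm_smul hs h0 hx0 (X ^ d + _), smul_add, smul_X_eq_monomial, add_comm]
      congr 2
      exact map_smul _ x c
    rw [Finset.sum_congr rfl h1, Finset.sum_const, Finset.card_erase_of_mem (Finset.mem_univ _),
      Finset.card_univ, nsmul_eq_mul, Nat.cast_sub Fintype.card_pos]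
    have h2 : ((Fintype.card F : ℕ) : MvPolynomial (Fin s) (RatFunc F)) = 0 := by
      rw [← map_natCast (algebraMap F _), FiniteField.cast_card_eq_zero, map_zero]
    rw [h2]
    simp

theorem geom_sum_card_mul_add_one (i : ℕ) :
    (∑ l ∈ Finset.range i, Fintype.card F ^ l) * (Fintype.card F - 1) + 1 = Fintype.card F ^ i := by
  have h := geom_sum_mul_add (Fintype.card F - 1) i
  have h1 : Fintype.card F - 1 + 1 = Fintype.card F := Nat.sub_add_cancel Fintype.card_pos
  rwa [h1] at h

variable (F) in
/-- The `i`-th power of the `q`-Frobenius map as a linear map. -/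
def frobeniusPow (R : Type*) [CommRing R] [Algebra F R] (i : ℕ) : R →ₗ[F] R :=
  (FiniteField.frobeniusAlgHom F R ^ i).toLinearMap

theorem frobeniusPow_apply {R : Type*} [CommRing R] [Algebra F R] (i : ℕ) (x : R) :
    frobeniusPow F R i x = x ^ (Fintype.card F ^ i) := by
  have : ∀ x, (FiniteField.frobeniusAlgHom F R ^ i) x = x ^ (Fintype.card F ^ i) := by
    induction i with
    | zero => simp
    | succ i ih =>
      intro x
      rw [pow_succ, AlgHom.mul_apply, ih, FiniteField.coe_frobeniusAlgHom, ← pow_mul, pow_succ']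
  exact this x

/-- As q^i - 1 = (q-1)(1 + q + ⋯ + q^(i-1)), the power of `L` is a product of (q-1)i linear forms,
namely Frobenius twists of `L`. -/
theorem sum_pow_mul_prod_linearMap_eq_zero {R ι : Type*} [CommRing R] [Algebra F R] {d i : ℕ}
    (L : (Fin d → F) →ₗ[F] R) (T : Finset ι) (ℓ : ι → (Fin d → F) →ₗ[F] R)
    (h : (Fintype.card F - 1) * i + T.card < (Fintype.card F - 1) * d) :
    ∑ x : Fin d → F, L x ^ (Fintype.card F ^ i - 1) * ∏ r ∈ T, ℓ r x = 0 := by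
  classical
  have key := sum_prod_linearMap_eq_zero
    ((Finset.range i ×ˢ Finset.range (Fintype.card F - 1)).disjSum T)
    (Sum.elim (fun p => (frobeniusPow F R p.1) ∘ₗ L) ℓ)
    (by rw [Finset.card_disjSum, Finset.card_product, Finset.card_range, Finset.card_range,
          mul_comm i]; exact h)
  rw [← key]
  refine Finset.sum_congr rfl fun x _ => ?_
  rw [Finset.prod_disjSum, Finset.prod_product]
  simp only [Sum.elim_inl, Sum.elim_inr, LinearMap.comp_apply, frobeniusPow_apply,
    Finset.prod_const, Finset.card_range, ← pow_mul]
  rw [Finset.prod_pow_eq_pow_sum, ← Finset.sum_mul, ← geom_sum_card_mul_add_one i,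
    Nat.add_sub_cancel]

variable (F) in
/-- The embedding of `A` into `K[t_1, …, t_s]` as a linear map. -/
def constLinear (s : ℕ) : F[X] →ₗ[F] MvPolynomial (Fin s) (RatFunc F) :=
  (Algebra.linearMap (RatFunc F) (MvPolynomial (Fin s) (RatFunc F))).restrictScalars F ∘ₗ
    (Algebra.linearMap F[X] (RatFunc F)).restrictScalars F

theorem constLinear_apply (s : ℕ) (a : F[X]) :
    constLinear F s a = MvPolynomial.C (algebraMap F[X] (RatFunc F) a) := rfl

theorem sum_inv_mul_newtonCoeff_eq_zero {ι : Type*} {s d k : ℕ} {T : Finset ι} (hT : T.Nonempty)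
    (ℓ : ι → F[X] →ₗ[F] MvPolynomial (Fin s) (RatFunc F))
    (h : (Fintype.card F - 1) * k + T.card < (Fintype.card F - 1) * d) :
    ∑ c : Fin d → F, MvPolynomial.C ((algebraMap F[X] (RatFunc F) (ofCoeffs F d c))⁻¹ *
      algebraMap F[X] (RatFunc F) (newtonCoeff F k (ofCoeffs F d c))) *
      ∏ r ∈ T, ℓ r (ofCoeffs F d c) = 0 := by
  obtain ⟨e, he⟩ := exists_newtonCoeff_eq_sum_pow (F := F) k
  have h1 : ∀ c : Fin d → F, MvPolynomial.C ((algebraMap F[X] (RatFunc F) (ofCoeffs F d c))⁻¹ *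
      algebraMap F[X] (RatFunc F) (newtonCoeff F k (ofCoeffs F d c))) *
      ∏ r ∈ T, ℓ r (ofCoeffs F d c) = ∑ i ∈ Finset.range (k + 1), MvPolynomial.C (e i) *
        ((constLinear F s ∘ₗ ofCoeffs F d) c ^ (Fintype.card F ^ i - 1) *
          ∏ r ∈ T, (ℓ r ∘ₗ ofCoeffs F d) c) := by
    intro c
    simp only [LinearMap.comp_apply]
    -- At a = 0 the left side has 0⁻¹ = 0, while the term `i = 0` on the right contains 0^0 = 1; a
    -- factor with index in the nonempty set `T` vanishes there.
    rcases eq_or_ne (ofCoeffs F d c) 0 with h0 | h0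
    · have h2 : ∏ r ∈ T, ℓ r 0 = 0 := by
        obtain ⟨r, hr⟩ := hT
        exact Finset.prod_eq_zero hr (map_zero _)
      simp only [h0, h2, mul_zero, Finset.sum_const_zero]
    · have h0' : algebraMap F[X] (RatFunc F) (ofCoeffs F d c) ≠ 0 := by simpa using h0
      rw [he, Finset.mul_sum, map_sum, Finset.sum_mul]
      refine Finset.sum_congr rfl fun i _ => ?_
      rw [constLinear_apply, ← map_pow MvPolynomial.C, ← mul_assoc (MvPolynomial.C (e i)),
        ← map_mul MvPolynomial.C]
      congr 2
      obtain ⟨t, ht⟩ := Nat.exists_eq_succ_of_ne_zero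
        (pow_ne_zero i Fintype.card_ne_zero : Fintype.card F ^ i ≠ 0)
      rw [ht, Nat.succ_sub_one, pow_succ', mul_left_comm, inv_mul_cancel_left₀ h0']
  simp only [h1]
  rw [Finset.sum_comm]
  refine Finset.sum_eq_zero fun i hi => ?_
  rw [← Finset.mul_sum, sum_pow_mul_prod_linearMap_eq_zero, mul_zero]
  have := Nat.mul_le_mul_left (Fintype.card F - 1) (Nat.lt_succ_iff.1 (Finset.mem_range.1 hi))
  omega

/-! ### Splitting off the factors b_n(t_j) -/

/-- `(t_j - θ^(q^n)) ⋯ (t_j - θ^(q^(n+k-1)))`. -/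
def shiftedB {s : ℕ} (n k : ℕ) (j : Fin s) : MvPolynomial (Fin s) F[X] :=
  ∏ r ∈ Finset.range k, (MvPolynomial.X j - MvPolynomial.C (X ^ (Fintype.card F ^ (n + r))))

theorem carlitzB_add {s : ℕ} (n k : ℕ) (j : Fin s) :
    carlitzB F (n + k) j = carlitzB F n j * shiftedB n k j := by
  rw [carlitzB, carlitzB, shiftedB, Finset.prod_range_add]

/-- The remainder of `a(t_j)` after division by `b_n(t_j)`. -/
def newtonRem {s : ℕ} (n : ℕ) (j : Fin s) (a : F[X]) : MvPolynomial (Fin s) F[X] :=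
  ∑ k ∈ Finset.range n, MvPolynomial.C (newtonCoeff F k a) * carlitzB F k j

/-- The quotient of `a(t_j)` by `b_n(t_j)`, for `a` of degree less than `n + m`. -/
def newtonQuot {s : ℕ} (n m : ℕ) (j : Fin s) (a : F[X]) : MvPolynomial (Fin s) F[X] :=
  ∑ k ∈ Finset.range m, MvPolynomial.C (newtonCoeff F (n + k) a) * shiftedB n k j

theorem aeval_X_eq_newtonRem_add {s n m : ℕ} (j : Fin s) {a : F[X]}
    (h : a.degree < (n + m : ℕ)) :
    aeval (MvPolynomial.X j : MvPolynomial (Fin s) F[X]) a =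
      newtonRem n j a + carlitzB F n j * newtonQuot n m j a := by
  rw [aeval_X_eq_sum_newtonCoeff j h, Finset.sum_range_add, newtonRem, newtonQuot, Finset.mul_sum]
  refine congrArg (_ + ·) (Finset.sum_congr rfl fun k _ => ?_)
  rw [carlitzB_add, mul_left_comm]

theorem polyAToK_aeval_X {s : ℕ} (j : Fin s) (a : F[X]) :
    polyAToK F s (aeval (MvPolynomial.X j : MvPolynomial (Fin s) F[X]) a) =
      aeval (MvPolynomial.X j : MvPolynomial (Fin s) (RatFunc F)) a := by
  rw [aeval_def, hom_eval₂, aeval_def]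
  congr 1
  · ext x
    simp only [polyAToK, RingHom.comp_apply]
    have : algebraMap F (MvPolynomial (Fin s) F[X]) x = MvPolynomial.C (algebraMap F F[X] x) := rfl
    rw [this, MvPolynomial.map_C, ← IsScalarTower.algebraMap_apply]
    rfl
  · simp [polyAToK]

variable (F) in
/-- The embedding of `A[t_1, …, t_s]` into `K[t_1, …, t_s]` as a linear map. -/
def polyAToKLinear (s : ℕ) :
    MvPolynomial (Fin s) F[X] →ₗ[F] MvPolynomial (Fin s) (RatFunc F) where
  toFun := polyAToK F s
  map_add' := map_add _
  map_smul' x p := by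
    have : algebraMap F (MvPolynomial (Fin s) F[X]) x = MvPolynomial.C (algebraMap F F[X] x) := rfl
    rw [Algebra.smul_def, this, map_mul, polyAToK, MvPolynomial.map_C,
      ← IsScalarTower.algebraMap_apply, RingHom.id_apply, Algebra.smul_def]
    rfl

/-- Linear combinations of Newton coefficients as linear maps. -/
def newtonComb {s : ℕ} (n m : ℕ) (b : ℕ → MvPolynomial (Fin s) F[X]) :
    F[X] →ₗ[F] MvPolynomial (Fin s) (RatFunc F) :=
  polyAToKLinear F s ∘ₗ ∑ k ∈ Finset.range m, LinearMap.mulRight F (b k) ∘ₗ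
    (Algebra.linearMap F[X] (MvPolynomial (Fin s) F[X])).restrictScalars F ∘ₗ newtonCoeff F (n + k)

theorem newtonComb_apply {s : ℕ} (n m : ℕ) (b : ℕ → MvPolynomial (Fin s) F[X]) (a : F[X]) :
    newtonComb n m b a = polyAToK F s
      (∑ k ∈ Finset.range m, MvPolynomial.C (newtonCoeff F (n + k) a) * b k) := by
  rw [newtonComb, LinearMap.comp_apply, LinearMap.sum_apply]
  rfl

/-- After expanding ∏_j (remainder + b_n(t_j) · quotient), only the product of the quotients
survives the summation over `a`. -/
theorem harmonicSum_eq_prod_carlitzB_mul {s n m : ℕ} (hs : s = (Fintype.card F - 1) * m + 1)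
    (h1 : s ≠ 1) :
    harmonicSum F s 1 (n + m) = polyAToK F s (∏ j, carlitzB F n j) *
      -∑ c : Fin (n + m) → F,
        MvPolynomial.C (algebraMap F[X] (RatFunc F) (ofCoeffs F (n + m) c))⁻¹ *
          polyAToK F s (∏ j, newtonQuot n m j (ofCoeffs F (n + m) c)) := by
  classical
  have hdvd : Fintype.card F - 1 ∣ s - 1 := by rw [hs, Nat.add_sub_cancel]; exact dvd_mul_right _ _
  have h0 : s ≠ 0 := by omega
  rw [neg_eq_iff_eq_neg.1 (sum_twistedTerm hdvd h0 (n + m)).symm, mul_neg, neg_inj,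
    Finset.mul_sum]
  have hterm : ∀ c : Fin (n + m) → F, twistedTerm F s (ofCoeffs F (n + m) c) =
      ∑ t ∈ (Finset.univ : Finset (Fin s)).powerset,
      MvPolynomial.C (algebraMap F[X] (RatFunc F) (ofCoeffs F (n + m) c))⁻¹ *
      ((∏ j ∈ t, polyAToK F s (newtonRem n j (ofCoeffs F (n + m) c))) *
        ∏ j ∈ Finset.univ \ t, polyAToK F s
          (carlitzB F n j * newtonQuot n m j (ofCoeffs F (n + m) c))) := by
    intro c
    rw [twistedTerm, ← Finset.mul_sum, ← Finset.prod_add]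
    congr 1
    refine Finset.prod_congr rfl fun j _ => ?_
    rw [← polyAToK_aeval_X, aeval_X_eq_newtonRem_add j (degree_ofCoeffs_lt c), map_add]
  simp only [hterm]
  rw [Finset.sum_comm, Finset.sum_eq_single_of_mem ∅ (Finset.empty_mem_powerset _)]
  · refine Finset.sum_congr rfl fun c _ => ?_
    rw [Finset.prod_empty, one_mul, Finset.sdiff_empty, ← map_prod, Finset.prod_mul_distrib,
      map_mul]
    ring
  · intro t _ ht
    -- One remainder, at `j₀`, is spent on cancelling 1/a: its Newton coefficients have index k < n
    -- and leave at most (q-1)k linear forms. The other s - 1 = (q-1)m factors are linear forms too,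
    -- and (q-1)(k+m) < (q-1)(n+m).
    obtain ⟨j₀, hj₀⟩ := Finset.nonempty_iff_ne_empty.2 ht
    let ℓ : Fin s → F[X] →ₗ[F] MvPolynomial (Fin s) (RatFunc F) := fun j =>
      if j ∈ t then newtonComb 0 n fun k => carlitzB F k j
      else newtonComb n m fun k => carlitzB F n j * shiftedB n k j
    have hsplit : ∀ a : F[X], (∏ j ∈ t, polyAToK F s (newtonRem n j a)) *
        ∏ j ∈ Finset.univ \ t, polyAToK F s (carlitzB F n j * newtonQuot n m j a) =
        polyAToK F s (newtonRem n j₀ a) * ∏ j ∈ Finset.univ.erase j₀, ℓ j a := by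
      intro a
      have e1 : ∀ j ∈ t, polyAToK F s (newtonRem n j a) = ℓ j a := by
        intro j hj
        simp only [ℓ, if_pos hj, newtonComb_apply, newtonRem, zero_add]
      have e2 : ∀ j ∈ Finset.univ \ t,
          polyAToK F s (carlitzB F n j * newtonQuot n m j a) = ℓ j a := by
        intro j hj
        simp only [ℓ, if_neg (Finset.mem_sdiff.1 hj).2, newtonComb_apply, newtonQuot,
          Finset.mul_sum, mul_left_comm]
      rw [Finset.prod_congr rfl e1, Finset.prod_congr rfl e2, e1 j₀ hj₀,
        Finset.mul_prod_erase _ (fun j => ℓ j a) (Finset.mem_univ j₀), mul_comm,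
        Finset.prod_sdiff (Finset.subset_univ t)]
    simp only [hsplit]
    simp only [newtonRem, map_sum, Finset.sum_mul, Finset.mul_sum, map_mul]
    rw [Finset.sum_comm]
    refine Finset.sum_eq_zero fun k hk => ?_
    have hT : ((Finset.univ : Finset (Fin s)).erase j₀).card = s - 1 := by
      rw [Finset.card_erase_of_mem (Finset.mem_univ _), Finset.card_univ, Fintype.card_fin]
    have key := sum_inv_mul_newtonCoeff_eq_zero (s := s) (d := n + m) (k := k)
      (T := (Finset.univ : Finset (Fin s)).erase j₀)
      (Finset.card_pos.1 (by omega)) ℓ (by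
        rw [hT, hs, Nat.add_sub_cancel, ← mul_add]
        refine Nat.mul_lt_mul_of_pos_left ?_ ?_
        · have := Finset.mem_range.1 hk
          omega
        · have := Fintype.one_lt_card (α := F)
          omega)
    rw [← mul_zero (polyAToK F s (carlitzB F k j₀)), ← key, Finset.mul_sum]
    refine Finset.sum_congr rfl fun c _ => ?_
    rw [map_mul, polyAToK, MvPolynomial.map_C]
    ring

end

section

variable {F : Type*} [Field F] [Fintype F]

/-! ### Integrality of the harmonic sums -/

theorem sum_add_pow_card_sub_one {K : Type*} [CommRing K] [Algebra F K] (y : K) :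
    ∑ x : F, (y + algebraMap F K x) ^ (Fintype.card F - 1) = -1 := by
  have hq : 0 < Fintype.card F - 1 := by
    have := Fintype.one_lt_card (α := F)
    omega
  simp only [add_pow]
  rw [Finset.sum_comm]
  have h : ∀ i ∈ Finset.range (Fintype.card F - 1 + 1),
      ∑ x : F, y ^ i * algebraMap F K x ^ (Fintype.card F - 1 - i) *
        ((Fintype.card F - 1).choose i : K) = if i = 0 then -1 else 0 := by
    intro i _
    rw [← Finset.sum_mul, ← Finset.mul_sum]
    simp only [← map_pow]
    rw [← map_sum]
    split_ifs with h0
    · subst h0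
      have h1 : ∑ x : F, x ^ (Fintype.card F - 1) = -1 := by
        classical
        rw [← Finset.add_sum_erase _ _ (Finset.mem_univ (0 : F)), zero_pow hq.ne', zero_add,
          Finset.sum_congr rfl fun x hx => FiniteField.pow_card_sub_one_eq_one x
            (Finset.ne_of_mem_erase hx), Finset.sum_const,
          Finset.card_erase_of_mem (Finset.mem_univ _), Finset.card_univ, nsmul_eq_mul,
          Nat.cast_sub Fintype.card_pos, FiniteField.cast_card_eq_zero]
        simp
      simp [h1]
    · rw [FiniteField.sum_pow_lt_card_sub_one F _ (by omega), map_zero, mul_zero, zero_mul]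
  rw [Finset.sum_congr rfl h, Finset.sum_ite_eq' _ 0, if_pos (Finset.mem_range.2 (by omega))]

/-- A logarithmic derivative: y^q - y is the product of the y + x, and it equals (y+x)^q - (y+x) for
each x in `F`, so each summand becomes (y+x)^(q-1) - 1. -/
theorem sum_inv_add_algebraMap {K : Type*} [Field K] [Algebra F K] {y : K}
    (h : ∀ x : F, y + algebraMap F K x ≠ 0) :
    (y ^ Fintype.card F - y) * ∑ x : F, (y + algebraMap F K x)⁻¹ = -1 := by
  have hq : Fintype.card F - 1 + 1 = Fintype.card F := Nat.sub_add_cancel Fintype.card_pos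
  have hF : (Fintype.card F : K) = 0 := by
    rw [← map_natCast (algebraMap F K), FiniteField.cast_card_eq_zero, map_zero]
  have h1 : ∀ x : F, (y ^ Fintype.card F - y) * (y + algebraMap F K x)⁻¹ =
      (y + algebraMap F K x) ^ (Fintype.card F - 1) - 1 := by
    intro x
    have h2 : (y + algebraMap F K x) ^ Fintype.card F = y ^ Fintype.card F + algebraMap F K x := by
      have := map_add (FiniteField.frobeniusAlgHom F K) y (algebraMap F K x)
      rwa [AlgHom.commutes] at this
    have h3 : y ^ Fintype.card F - y =
        ((y + algebraMap F K x) ^ (Fintype.card F - 1) - 1) * (y + algebraMap F K x) := by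
      rw [sub_mul, ← pow_succ, hq, h2]
      ring
    rw [h3, mul_inv_cancel_right₀ (h x)]
  rw [Finset.mul_sum, Finset.sum_congr rfl fun x _ => h1 x, Finset.sum_sub_distrib,
    sum_add_pow_card_sub_one]
  simp [hF]

theorem newtonCoeff_monomial_self (n : ℕ) (x : F) : newtonCoeff F n (monomial n x) = C x := by
  rw [newtonCoeff_monomial, newtonMonomial_self, smul_eq_C_mul, mul_one]

theorem carlitzL_succ (n : ℕ) : carlitzL F (n + 1) = carlitzL F n * -bracket F (n + 1) := by
  rw [carlitzL, carlitzL, Finset.prod_range_succ, bracket, neg_sub]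

theorem carlitzL_ne_zero (n : ℕ) : carlitzL F n ≠ 0 := by
  induction n with
  | zero => simp [carlitzL]
  | succ n ih => rw [carlitzL_succ]; exact mul_ne_zero ih (neg_ne_zero.2 (bracket_ne_zero (by simp)))

/-- Induction on `n`: summing over the coefficient x of θ^n gives Σ_x 1/(Δ_n(u) + x) = -1/(Δ_n(u)^q
- Δ_n(u)) = -1/([n+1] Δ_{n+1}(u)), and -[n+1] is the new factor of l_{n+1}. -/
theorem sum_inv_add_ofCoeffs (n : ℕ) {u : F[X]} (hu : newtonCoeff F n u ≠ 0) :
    ∑ w : Fin n → F, (algebraMap F[X] (RatFunc F) (ofCoeffs F n w + u))⁻¹ =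
      (algebraMap F[X] (RatFunc F) (carlitzL F n * newtonCoeff F n u))⁻¹ := by
  induction n generalizing u with
  | zero => simp [carlitzL, newtonCoeff_zero_apply, ofCoeffs_apply]
  | succ n ih =>
    have hAS := newtonCoeff_pow_card n u
    -- If Δ_n(u) were a constant it would be fixed by the q-power map, and the Artin-Schreier
    -- relation would give Δ_{n+1}(u) = 0.
    have hne : ∀ x : F, newtonCoeff F n u + C x ≠ 0 := by
      intro x hx
      have h1 : newtonCoeff F n u = C (-x) := by rw [map_neg, eq_neg_iff_add_eq_zero, hx]
      rw [h1, ← map_pow, FiniteField.pow_card, left_eq_add] at hAS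
      exact mul_ne_zero (bracket_ne_zero n.succ_ne_zero) hu hAS
    have hshift : ∀ x : F, newtonCoeff F n (monomial n x + u) = newtonCoeff F n u + C x := by
      intro x
      rw [map_add, newtonCoeff_monomial_self, add_comm]
    rw [sum_snoc]
    simp only [ofCoeffs_snoc, add_assoc]
    have h2 : ∀ x : F, ∑ c : Fin n → F,
        (algebraMap F[X] (RatFunc F) (ofCoeffs F n c + (monomial n x + u)))⁻¹ =
        (algebraMap F[X] (RatFunc F) (carlitzL F n))⁻¹ *
          (algebraMap F[X] (RatFunc F) (newtonCoeff F n u) + algebraMap F (RatFunc F) x)⁻¹ := by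
      intro x
      rw [ih (by rw [hshift]; exact hne x), hshift, map_mul, mul_inv, map_add]
      rfl
    rw [Finset.sum_congr rfl fun x _ => h2 x, ← Finset.mul_sum]
    have h3 := sum_inv_add_algebraMap (y := algebraMap F[X] (RatFunc F) (newtonCoeff F n u))
      (fun x => by
        have : algebraMap F (RatFunc F) x = algebraMap F[X] (RatFunc F) (C x) := rfl
        rw [this, ← map_add, Ne, map_eq_zero_iff _ (RatFunc.algebraMap_injective F)]
        exact hne x)
    rw [← map_pow, ← map_sub, hAS, add_sub_cancel_left] at h3
    rw [carlitzL_succ, mul_assoc, map_mul, mul_inv, neg_mul, map_neg]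
    congr 1
    refine eq_inv_of_mul_eq_one_right ?_
    rw [neg_mul, h3, neg_neg]

/-- Δ_k(a) divides Δ_k(a)^q - Δ_k(a) = [k+1] Δ_{k+1}(a). Iterating up to the index deg a ends at the
leading coefficient, a unit. -/
theorem newtonCoeff_dvd_prod_bracket (r : ℕ) : ∀ (k : ℕ) (a : F[X]), a ≠ 0 →
    a.natDegree = k + r → newtonCoeff F k a ∣ ∏ i ∈ Finset.range r, bracket F (k + i + 1) := by
  induction r with
  | zero =>
    intro k a ha h
    rw [add_zero] at h
    subst h
    rw [newtonCoeff_natDegree]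
    exact (isUnit_C.2 (leadingCoeff_ne_zero.2 ha).isUnit).dvd
  | succ r ih =>
    intro k a ha h
    have h1 : newtonCoeff F k a ∣ bracket F (k + 1) * newtonCoeff F (k + 1) a := by
      rw [← sub_eq_iff_eq_add'.2 (newtonCoeff_pow_card k a)]
      exact dvd_sub (dvd_pow_self _ Fintype.card_ne_zero) dvd_rfl
    rw [Finset.prod_range_succ', mul_comm]
    refine h1.trans (mul_dvd_mul_left _ ?_)
    have h2 := ih (k + 1) a ha (by omega)
    simpa only [add_assoc, add_comm, add_left_comm] using h2

theorem carlitzL_add (n r : ℕ) : carlitzL F (n + r) =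
    carlitzL F n * ∏ i ∈ Finset.range r, (X - X ^ Fintype.card F ^ (n + i + 1)) := by
  rw [carlitzL, carlitzL, Finset.prod_range_add]

theorem newtonCoeff_X_pow_mul_ne_zero {n m : ℕ} {v : Fin m → F} (hv : v ≠ 0) :
    newtonCoeff F n (X ^ n * ofCoeffs F m v) ≠ 0 := by
  have hv' : ofCoeffs F m v ≠ 0 := fun h => hv (ofCoeffs_injective m (h.trans (map_zero _).symm))
  have h := newtonCoeff_dvd_prod_bracket (ofCoeffs F m v).natDegree n (X ^ n * ofCoeffs F m v)
    (mul_ne_zero (pow_ne_zero _ X_ne_zero) hv')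
    (by rw [natDegree_mul (pow_ne_zero _ X_ne_zero) hv', natDegree_X_pow])
  intro h0
  rw [h0, zero_dvd_iff, Finset.prod_eq_zero_iff] at h
  obtain ⟨i, _, hi⟩ := h
  exact bracket_ne_zero (Nat.succ_ne_zero _) hi

/-- The product on the right is l_{n+m-1}/l_n, so l_{d-1} clears the denominators l_n Δ_n(θ^n v). -/
theorem newtonCoeff_X_pow_mul_dvd {n m : ℕ} {v : Fin m → F} (hv : v ≠ 0) :
    newtonCoeff F n (X ^ n * ofCoeffs F m v) ∣
      ∏ i ∈ Finset.range (m - 1), (X - X ^ Fintype.card F ^ (n + i + 1)) := by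
  have hv' : ofCoeffs F m v ≠ 0 := fun h => hv (ofCoeffs_injective m (h.trans (map_zero _).symm))
  have h := newtonCoeff_dvd_prod_bracket (ofCoeffs F m v).natDegree n (X ^ n * ofCoeffs F m v)
    (mul_ne_zero (pow_ne_zero _ X_ne_zero) hv')
    (by rw [natDegree_mul (pow_ne_zero _ X_ne_zero) hv', natDegree_X_pow])
  have hdeg : (ofCoeffs F m v).natDegree < m :=
    (natDegree_lt_iff_degree_lt hv').2 (degree_ofCoeffs_lt v)
  refine h.trans ((Finset.prod_dvd_prod_of_dvd _ _ fun i _ => ?_).trans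
    (Finset.prod_dvd_prod_of_subset _ _ _ (Finset.range_subset_range.2 (by omega))))
  rw [bracket, ← neg_sub, neg_dvd]

/-- Newton coefficients of index at least n ignore terms of degree below n; hence the quotients
factor out of the sum over the low coefficients. -/
theorem newtonQuot_add_X_pow_mul {s n m : ℕ} (j : Fin s) (w : Fin n → F) (u : F[X]) :
    newtonQuot n m j (ofCoeffs F n w + u) = newtonQuot n m j u := by
  refine Finset.sum_congr rfl fun k _ => ?_
  rw [map_add, newtonCoeff_of_degree_lt, zero_add]
  exact (degree_ofCoeffs_lt w).trans_le (by exact_mod_cast Nat.le_add_right n k)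

theorem exists_harmonicSum_eq_bigPi_mul {s n m : ℕ} (hs : s = (Fintype.card F - 1) * m + 1)
    (hm : m ≠ 0) (hmi : mIndex F s = m) :
    ∃ e : (Fin m → F) → F[X], e 0 = 0 ∧
      (∀ v, v ≠ 0 → e v * newtonCoeff F n (X ^ n * ofCoeffs F m v) =
        ∏ i ∈ Finset.range (m - 1), (X - X ^ Fintype.card F ^ (n + i + 1))) ∧
      harmonicSum F s 1 (n + m) = bigPi F s (n + m) * polyAToK F s
        (-∑ v : Fin m → F, MvPolynomial.C (e v) *
          ∏ j, newtonQuot n m j (X ^ n * ofCoeffs F m v)) := by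
  classical
  have hq : Fintype.card F - 1 ≠ 0 := by
    have := Fintype.one_lt_card (α := F)
    omega
  have h1 : s ≠ 1 := by
    have := mul_ne_zero hq hm
    omega
  have hs0 : s ≠ 0 := by omega
  choose! e' he' using fun (v : Fin m → F) (hv : v ≠ 0) =>
    newtonCoeff_X_pow_mul_dvd (n := n) hv
  refine ⟨fun v => if v = 0 then 0 else e' v, if_pos rfl, fun v hv => ?_, ?_⟩
  · simp only [if_neg hv]
    rw [he' v hv, mul_comm]
  rw [harmonicSum_eq_prod_carlitzB_mul hs h1, bigPi, hmi, Nat.add_sub_cancel, ← map_prod,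
    mul_comm (MvPolynomial.C _), mul_assoc]
  congr 1
  rw [map_neg, mul_neg, neg_inj, sum_append, map_sum, Finset.mul_sum]
  refine Finset.sum_congr rfl fun v _ => ?_
  simp only [ofCoeffs_append, newtonQuot_add_X_pow_mul]
  rw [← Finset.sum_mul, ← map_sum]
  -- For v = 0 all quotients vanish, so the value of Σ_w 1/w is irrelevant and `e 0 = 0` is
  -- harmless.
  split_ifs with hv
  · subst hv
    have : Nonempty (Fin s) := ⟨⟨0, by omega⟩⟩
    simp [newtonQuot, Finset.prod_const, hs0]
  · have hx := newtonCoeff_X_pow_mul_ne_zero (n := n) hv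
    rw [sum_inv_add_ofCoeffs n hx, map_mul (polyAToK F s), ← mul_assoc]
    congr 1
    rw [polyAToK, MvPolynomial.map_C, ← map_mul]
    congr 1
    have hL : carlitzL F (n + m - 1) = carlitzL F n * (newtonCoeff F n (X ^ n * ofCoeffs F m v) *
        e' v) := by
      rw [← he' v hv, Nat.add_sub_assoc (by omega), carlitzL_add]
    have hL0 := carlitzL_ne_zero (F := F) (n + m - 1)
    have hL1 := carlitzL_ne_zero (F := F) n
    have hne : ∀ a : F[X], a ≠ 0 → algebraMap F[X] (RatFunc F) a ≠ 0 := fun a ha => by simpa using ha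
    rw [eq_inv_mul_iff_mul_eq₀ (hne _ hL0), hL, ← mul_assoc, map_mul _ (_ * _),
      mul_right_comm, mul_inv_cancel₀ (hne _ (mul_ne_zero hL1 hx)), one_mul]

end

section

/-! ### Sums over the roots of a polynomial -/

/-- If `Φ = ∏ (X - r_i)`, then `∑ g(r_i)` is the leading coefficient of `g Φ'` modulo `Φ`. -/
theorem coeff_mul_derivative_modByMonic {S ι : Type*} [CommRing S] [Nontrivial S] [Fintype ι]
    [Nonempty ι] (r : ι → S) (g : S[X]) :
    ((g * derivative (∏ i, (X - C (r i)))) %ₘ ∏ i, (X - C (r i))).coeff (Fintype.card ι - 1) =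
      ∑ i, g.eval (r i) := by
  classical
  have hmonic : (∏ i, (X - C (r i))).Monic := monic_prod_of_monic _ _ fun i _ => monic_X_sub_C _
  have hdeg : (∏ i, (X - C (r i))).natDegree = Fintype.card ι := by
    rw [natDegree_prod_of_monic _ _ fun i _ => monic_X_sub_C _]
    simp
  have hmonic' : ∀ i, (∏ j ∈ Finset.univ.erase i, (X - C (r j))).Monic :=
    fun i => monic_prod_of_monic _ _ fun i _ => monic_X_sub_C _
  have hdeg' : ∀ i, (∏ j ∈ Finset.univ.erase i, (X - C (r j))).natDegree =
      Fintype.card ι - 1 := by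
    intro i
    rw [natDegree_prod_of_monic _ _ fun i _ => monic_X_sub_C _]
    simp [Finset.card_erase_of_mem]
  have hpos : 0 < Fintype.card ι := Fintype.card_pos
  choose k hk using fun i => X_sub_C_dvd_sub_C_eval (a := r i) (p := g)
  -- Replacing `g` by g(r_i) in the i-th summand of gΦ' changes that summand by a multiple of Φ.
  -- What is left has degree below deg Φ, so it is the remainder.
  have hsplit : (∑ i, C (g.eval (r i)) * ∏ j ∈ Finset.univ.erase i, (X - C (r j))) +
      (∏ i, (X - C (r i))) * ∑ i, k i = g * derivative (∏ i, (X - C (r i))) := by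
    rw [derivative_prod_finset, Finset.mul_sum, Finset.mul_sum, ← Finset.sum_add_distrib]
    refine Finset.sum_congr rfl fun i _ => ?_
    rw [derivative_X_sub_C, mul_one, ← Finset.mul_prod_erase _ _ (Finset.mem_univ i)]
    have h := hk i
    rw [sub_eq_iff_eq_add] at h
    conv_rhs => rw [h]
    ring
  have hlt : (∑ i, C (g.eval (r i)) * ∏ j ∈ Finset.univ.erase i, (X - C (r j))).degree <
      (∏ i, (X - C (r i))).degree := by
    refine (degree_sum_le _ _).trans_lt ((Finset.sup_lt_iff
      (bot_lt_iff_ne_bot.2 (degree_ne_bot.2 hmonic.ne_zero))).2 fun i _ => degree_lt_degree ?_)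
    refine (natDegree_C_mul_le _ _).trans_lt ?_
    rw [hdeg, hdeg']
    exact Nat.sub_lt hpos one_pos
  rw [(div_modByMonic_unique _ _ hmonic ⟨hsplit, hlt⟩).2, finsetSum_coeff]
  refine Finset.sum_congr rfl fun i _ => ?_
  rw [coeff_C_mul, ← hdeg' i, (hmonic' i).coeff_natDegree, mul_one]

/-- Monic division commutes with specialization. Root sums can therefore be computed once with
generic coefficients in Y, although the roots themselves exist only after setting Y = θ^(q^n). -/
theorem map_coeff_mul_derivative_modByMonic {S S' : Type*} [CommRing S] [CommRing S']
    (f : S →+* S') (g : S[X]) {p : S[X]} (hp : p.Monic) (k : ℕ) :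
    f (((g * derivative p) %ₘ p).coeff k) =
      ((g.map f * derivative (p.map f)) %ₘ p.map f).coeff k := by
  rw [← coeff_map, map_modByMonic _ hp, Polynomial.map_mul, ← derivative_map]

theorem prod_X_sub_C_eq_of_monic {S ι : Type*} [CommRing S] [IsDomain S] [Fintype ι] {p : S[X]}
    (hp : p.Monic) {r : ι → S} (hr : Function.Injective r) (hroot : ∀ i, p.eval (r i) = 0)
    (hdeg : p.natDegree ≤ Fintype.card ι) : ∏ i, (X - C (r i)) = p := by
  classical
  have hmonic : (∏ i, (X - C (r i))).Monic := monic_prod_of_monic _ _ fun i _ => monic_X_sub_C _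
  refine (eq_of_monic_of_dvd_of_natDegree_le hmonic hp ?_ ?_).symm
  · have h := (Multiset.prod_X_sub_C_dvd_iff_le_roots hp.ne_zero (Finset.univ.val.map r)).2 ?_
    · rwa [Multiset.map_map] at h
    · rw [Multiset.le_iff_subset (Finset.univ.nodup.map hr)]
      intro x hx
      obtain ⟨i, _, rfl⟩ := Multiset.mem_map.1 hx
      exact (mem_roots hp.ne_zero).2 (hroot i)
  · rw [natDegree_prod_of_monic _ _ fun i _ => monic_X_sub_C _]
    simpa using hdeg

/-! ### The additive polynomials relating the Newton coefficients -/

section AddPoly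

variable {S : Type*} [CommRing S] (q : ℕ) (δ : ℕ → S)

/-- The common denominators of the polynomials `addPoly`. -/
def addDenom : ℕ → S
  | 0 => 1
  | k + 1 => δ k * addDenom k ^ q

/-- The monic additive polynomials given by `Φ_0 = X` and `Φ_{k+1} = Φ_k^q - Δ_k^(q-1) Φ_k`. -/
def addPoly : ℕ → S[X]
  | 0 => X
  | k + 1 => addPoly k ^ q - C (addDenom q δ k ^ (q - 1)) * addPoly k

variable {q δ}

theorem map_addDenom {S' : Type*} [CommRing S'] (f : S →+* S') (k : ℕ) :
    f (addDenom q δ k) = addDenom q (fun i => f (δ i)) k := by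
  induction k with
  | zero => simp [addDenom]
  | succ k ih => simp [addDenom, ih]

theorem map_addPoly {S' : Type*} [CommRing S'] (f : S →+* S') (k : ℕ) :
    (addPoly q δ k).map f = addPoly q (fun i => f (δ i)) k := by
  induction k with
  | zero => simp [addPoly]
  | succ k ih => simp [addPoly, ih, map_addDenom f k]

theorem addPoly_coeff_zero (hq : q ≠ 0) (k : ℕ) : (addPoly q δ k).coeff 0 = 0 := by
  rw [coeff_zero_eq_eval_zero]
  induction k with
  | zero => simp [addPoly]
  | succ k ih => simp [addPoly, ih, hq]

theorem addPoly_monic_and_natDegree [Nontrivial S] (hq : 1 < q) (k : ℕ) :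
    (addPoly q δ k).Monic ∧ (addPoly q δ k).natDegree = q ^ k := by
  induction k with
  | zero => exact ⟨monic_X, by simp [addPoly]⟩
  | succ k ih =>
    obtain ⟨h1, h2⟩ := ih
    have h3 : (addPoly q δ k ^ q).natDegree = q ^ (k + 1) := by
      rw [h1.natDegree_pow, h2, pow_succ']
    have h4 : (C (addDenom q δ k ^ (q - 1)) * addPoly q δ k).natDegree <
        (addPoly q δ k ^ q).natDegree := by
      refine (natDegree_C_mul_le _ _).trans_lt ?_
      rw [h3, h2]
      exact Nat.pow_lt_pow_right hq (Nat.lt_succ_self k)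
    refine ⟨(h1.pow q).sub_of_left (degree_lt_degree h4), ?_⟩
    rw [addPoly, natDegree_sub_eq_left_of_natDegree_lt h4, h3]

theorem addDenom_monic {R : Type*} [CommRing R] {δ : ℕ → R[X]} (h : ∀ k, (δ k).Monic) (k : ℕ) :
    (addDenom q δ k).Monic := by
  induction k with
  | zero => exact monic_one
  | succ k ih => exact (h k).mul (ih.pow q)

end AddPoly

variable {F : Type*} [Field F] [Fintype F]

/-- Iterating the Artin-Schreier relation makes every Δ_{n+k}(u) a polynomial in the single quantity
Δ_n(u), up to a denominator. -/
theorem eval_addPoly_newtonCoeff (n k : ℕ) (u : F[X]) :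
    (addPoly (Fintype.card F) (fun k => bracket F (n + k + 1)) k).eval (newtonCoeff F n u) =
      addDenom (Fintype.card F) (fun k => bracket F (n + k + 1)) k * newtonCoeff F (n + k) u := by
  induction k with
  | zero => simp [addPoly, addDenom]
  | succ k ih =>
    have hq : Fintype.card F - 1 + 1 = Fintype.card F := Nat.sub_add_cancel Fintype.card_pos
    rw [addPoly, eval_sub, eval_pow, eval_mul, eval_C, ih, mul_pow, ← mul_assoc, ← pow_succ, hq,
      newtonCoeff_pow_card, addDenom]
    rw [← add_assoc n k 1]
    ring

theorem newtonCoeff_X_pow_mul_injective (n m : ℕ) :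
    Function.Injective fun v : Fin m → F => newtonCoeff F n (X ^ n * ofCoeffs F m v) := by
  intro v v' h
  by_contra hne
  refine newtonCoeff_X_pow_mul_ne_zero (n := n) (sub_ne_zero.2 hne) ?_
  rw [map_sub, mul_sub, map_sub]
  exact sub_eq_zero.2 h

/-- Each Δ_n(θ^n v) is a root because Δ_{n+m} kills polynomials of degree below n + m. These q^m
roots are distinct and exhaust the degree. -/
theorem prod_X_sub_C_newtonCoeff (n m : ℕ) :
    ∏ v : Fin m → F, (X - C (newtonCoeff F n (X ^ n * ofCoeffs F m v))) =
      addPoly (Fintype.card F) (fun k => bracket F (n + k + 1)) m := by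
  obtain ⟨h1, h2⟩ := addPoly_monic_and_natDegree (δ := fun k => bracket F (n + k + 1))
    (Fintype.one_lt_card (α := F)) m
  refine prod_X_sub_C_eq_of_monic h1 (newtonCoeff_X_pow_mul_injective n m) (fun v => ?_) ?_
  · rw [eval_addPoly_newtonCoeff, newtonCoeff_of_degree_lt, mul_zero]
    rw [degree_mul, degree_X_pow, Nat.cast_add]
    exact WithBot.add_lt_add_left (by simp) (degree_ofCoeffs_lt v)
  · rw [h2]; simp

/-! ### The numerator and the denominator of the interpolating polynomial -/

variable (F) in
/-- `Y^(q^(k+1)) - θ`. -/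
def genericBracket (k : ℕ) : F[X][X] := X ^ (Fintype.card F ^ (k + 1)) - C X

theorem genericBracket_monic (k : ℕ) : (genericBracket F k).Monic :=
  monic_X_pow_sub_C _ (pow_ne_zero _ Fintype.card_ne_zero)

theorem eval_genericBracket (n k : ℕ) :
    (genericBracket F k).eval (X ^ (Fintype.card F ^ n)) = bracket F (n + k + 1) := by
  simp [genericBracket, bracket, ← pow_mul, ← pow_add, add_assoc]

variable (F) in
/-- The denominator of the interpolating polynomial. -/
def interpDenom (m : ℕ) : F[X][X] :=
  ∏ k ∈ Finset.range m, addDenom (Fintype.card F) (genericBracket F) k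

section Generic

variable {B : Type*} [CommRing B] (ι : F[X] →+* B) {s : ℕ} (x : Fin s → B)

/-- A multiple of the coefficient of `Φ_k` in the quotient of `a(x_j)` by `b_n(x_j)`, with
`θ^(q^n)` replaced by `Y`. -/
def genericQuotCoeff (m : ℕ) (j : Fin s) (k : ℕ) : B[X] :=
  (∏ r ∈ Finset.range k, (C (x j) - X ^ (Fintype.card F ^ r))) *
    (∏ i ∈ (Finset.range m).erase k, addDenom (Fintype.card F) (genericBracket F) i).map ι

/-- The polynomials `Φ_k` with `θ^(q^n)` replaced by `Y`. -/
def genericAddPoly (k : ℕ) : B[X][X] :=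
  addPoly (Fintype.card F) (fun i => (genericBracket F i).map ι) k

/-- The product over `j` of multiples of the quotients by `b_n(x_j)`, divided by the variable. -/
def genericProd (m : ℕ) : B[X][X] :=
  X ^ (s - 1) * ∏ j : Fin s, ∑ k ∈ Finset.range m,
    C (genericQuotCoeff ι x m j k) * (genericAddPoly ι k).divX

/-- The numerator of the interpolating polynomial. -/
def interpNumer (m : ℕ) : B[X] :=
  -(∏ i ∈ Finset.range (m - 1), (C (ι X) - X ^ (Fintype.card F ^ (i + 1)))) *
    ((genericProd ι x m * derivative (genericAddPoly ι m)) %ₘ genericAddPoly ι m).coeff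
      (Fintype.card F ^ m - 1)

/-- Specialization at `Y = θ^(q^n)`. -/
def specialize (n : ℕ) : B[X] →+* B := evalRingHom (ι (X ^ (Fintype.card F ^ n)))

/-- The value at `x_j` of the quotient of `a(t)` by `b_n(t)`, for `a` of degree less than
`n + m`. -/
def quotValue (n m : ℕ) (j : Fin s) (u : F[X]) : B :=
  ∑ k ∈ Finset.range m, ι (newtonCoeff F (n + k) u) *
    ∏ r ∈ Finset.range k, (x j - ι (X ^ (Fintype.card F ^ (n + r))))

variable {ι x}

theorem specialize_map (n : ℕ) (p : F[X][X]) : specialize ι n (p.map ι) =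
    ι (p.eval (X ^ (Fintype.card F ^ n))) := by
  rw [specialize, coe_evalRingHom, eval_map, eval₂_at_apply]

theorem map_specialize_genericAddPoly (n k : ℕ) :
    (genericAddPoly ι k).map (specialize ι n) =
      (addPoly (Fintype.card F) (fun k => bracket F (n + k + 1)) k).map ι := by
  rw [genericAddPoly, map_addPoly, map_addPoly]
  simp only [specialize_map, eval_genericBracket]

/-- The k-th factor, omitted from the common denominator in `genericQuotCoeff`, is supplied by the
denominator of Φ_k. -/
theorem specialize_genericQuotCoeff (n m : ℕ) (j : Fin s) {k : ℕ} (hk : k < m) :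
    specialize ι n (genericQuotCoeff ι x m j k) *
      ι (addDenom (Fintype.card F) (fun k => bracket F (n + k + 1)) k) =
      (∏ r ∈ Finset.range k, (x j - ι (X ^ (Fintype.card F ^ (n + r))))) *
        ι ((interpDenom F m).eval (X ^ (Fintype.card F ^ n))) := by
  have h1 : addDenom (Fintype.card F) (fun k => bracket F (n + k + 1)) k =
      (addDenom (Fintype.card F) (genericBracket F) k).eval (X ^ (Fintype.card F ^ n)) := by
    rw [← coe_evalRingHom, map_addDenom]
    simp only [coe_evalRingHom, eval_genericBracket]
  rw [genericQuotCoeff, map_mul, specialize_map, h1, mul_assoc, ← map_mul ι,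
    ← eval_mul, mul_comm (∏ i ∈ (Finset.range m).erase k, _),
    Finset.mul_prod_erase _ _ (Finset.mem_range.2 hk), interpDenom]
  congr 1
  rw [map_prod]
  refine Finset.prod_congr rfl fun r _ => ?_
  rw [specialize, coe_evalRingHom, eval_sub, eval_pow, eval_C, eval_X, ← map_pow, ← pow_mul,
    ← pow_add]

theorem X_mul_genericProd (hs : s ≠ 0) (m : ℕ) : X * genericProd ι x m =
    ∏ j : Fin s, ∑ k ∈ Finset.range m, C (genericQuotCoeff ι x m j k) * genericAddPoly ι k := by
  have h1 : ∀ k, X * (genericAddPoly ι k).divX = genericAddPoly ι k := by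
    intro k
    have := X_mul_divX_add (genericAddPoly ι k)
    rwa [genericAddPoly, addPoly_coeff_zero Fintype.card_ne_zero, map_zero, add_zero] at this
  have h2 : ∀ j : Fin s, ∑ k ∈ Finset.range m,
      C (genericQuotCoeff ι x m j k) * genericAddPoly ι k =
      X * ∑ k ∈ Finset.range m, C (genericQuotCoeff ι x m j k) * (genericAddPoly ι k).divX := by
    intro j
    rw [Finset.mul_sum]
    refine Finset.sum_congr rfl fun k _ => ?_
    rw [mul_left_comm, h1]
  rw [Finset.prod_congr rfl fun j _ => h2 j, Finset.prod_mul_distrib, Finset.prod_const,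
    Finset.card_univ, Fintype.card_fin, genericProd, ← mul_assoc, ← pow_succ',
    Nat.sub_add_cancel (by omega)]

/-- All s quotients are expressed in x = Δ_n(u) with cleared denominators; the extra factor x on the
left restores the one removed in `genericProd`. -/
theorem mul_eval_genericProd (hs : s ≠ 0) (n m : ℕ) (u : F[X]) :
    ι (newtonCoeff F n u) * ((genericProd ι x m).map (specialize ι n)).eval
      (ι (newtonCoeff F n u)) =
      ι ((interpDenom F m ^ s).eval (X ^ (Fintype.card F ^ n))) *
        ∏ j, quotValue ι x n m j u := by
  have h := congrArg (fun p => (p.map (specialize ι n)).eval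
    (ι (newtonCoeff F n u))) (X_mul_genericProd (ι := ι) (x := x) hs m)
  simp only [Polynomial.map_mul, map_X, eval_mul, eval_X] at h
  rw [h, Polynomial.map_prod, eval_prod, eval_pow, map_pow]
  have h2 : ∀ j : Fin s, eval (ι (newtonCoeff F n u)) ((∑ k ∈ Finset.range m,
      C (genericQuotCoeff ι x m j k) * genericAddPoly ι k).map (specialize ι n)) =
      ι ((interpDenom F m).eval (X ^ (Fintype.card F ^ n))) * quotValue ι x n m j u := by
    intro j
    rw [Polynomial.map_sum, eval_finsetSum, quotValue, Finset.mul_sum]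
    refine Finset.sum_congr rfl fun k hk => ?_
    rw [Polynomial.map_mul, map_C, eval_mul, eval_C, map_specialize_genericAddPoly, eval_map,
      eval₂_at_apply, eval_addPoly_newtonCoeff, map_mul, ← mul_assoc,
      specialize_genericQuotCoeff n m j (Finset.mem_range.1 hk)]
    ring
  rw [Finset.prod_congr rfl fun j _ => h2 j, Finset.prod_mul_distrib, Finset.prod_const,
    Finset.card_univ, Fintype.card_fin]

variable (F) in
theorem interpDenom_monic (m : ℕ) : (interpDenom F m).Monic :=
  monic_prod_of_monic _ _ fun k _ => addDenom_monic genericBracket_monic k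

/-- The factor e(v) is the bracket product divided by Δ_n(θ^n v), and `genericProd` already carries
that division. The sum over v is thus a sum over the roots of Φ_m, computed by
`coeff_mul_derivative_modByMonic`. -/
theorem interpDenom_mul_eq_interpNumer [Nontrivial B] {n m : ℕ} (hs : 1 < s)
    {e : (Fin m → F) → F[X]}
    (he0 : e 0 = 0) (he : ∀ v, v ≠ 0 → e v * newtonCoeff F n (X ^ n * ofCoeffs F m v) =
      ∏ i ∈ Finset.range (m - 1), (X - X ^ Fintype.card F ^ (n + i + 1))) :
    ι ((interpDenom F m ^ s).eval (X ^ (Fintype.card F ^ n))) *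
      (-∑ v : Fin m → F, ι (e v) * ∏ j : Fin s, quotValue ι x n m j (X ^ n * ofCoeffs F m v)) =
      specialize ι n (interpNumer ι x m) := by
  have hprod : (genericAddPoly ι m).map (specialize ι n) = ∏ v : Fin m → F,
      (X - C (ι (newtonCoeff F n (X ^ n * ofCoeffs F m v)))) := by
    rw [map_specialize_genericAddPoly, ← prod_X_sub_C_newtonCoeff, Polynomial.map_prod]
    simp
  have hcard : Fintype.card F ^ m = Fintype.card (Fin m → F) := by simp
  have hmonic : (genericAddPoly ι m).Monic :=
    (addPoly_monic_and_natDegree (Fintype.one_lt_card (α := F)) m).1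
  have hT := map_coeff_mul_derivative_modByMonic (specialize ι n) (genericProd ι x m) hmonic
    (Fintype.card F ^ m - 1)
  rw [hprod, hcard, coeff_mul_derivative_modByMonic] at hT
  rw [interpNumer, map_mul, hcard, hT, map_neg, neg_mul, mul_neg,
    neg_inj, Finset.mul_sum, Finset.mul_sum]
  refine Finset.sum_congr rfl fun v _ => ?_
  -- The root 0 contributes nothing: s > 1 leaves a positive power of the variable in `genericProd`.
  rcases eq_or_ne v 0 with rfl | hv
  · have h0 : (genericProd ι x m).coeff 0 = 0 := by
      rw [coeff_zero_eq_eval_zero, genericProd, eval_mul, eval_pow, eval_X,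
        zero_pow (by omega), zero_mul]
    rw [he0, map_zero, zero_mul, mul_zero, map_zero, mul_zero, map_zero, map_zero,
      ← coeff_zero_eq_eval_zero, coeff_map, h0, map_zero, mul_zero]
  · rw [mul_left_comm, ← mul_eval_genericProd (by omega), ← mul_assoc, ← map_mul, he v hv]
    congr 1
    rw [map_prod, map_prod]
    refine Finset.prod_congr rfl fun i _ => ?_
    rw [map_sub, specialize, coe_evalRingHom, eval_sub, eval_pow, eval_C, eval_X, ← map_pow,
      ← pow_mul, ← pow_add, add_assoc]

end Generic

end

section

variable {F : Type*} [Field F] [Fintype F]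

/-! ### The interpolating polynomial -/

theorem exists_natDegree_eval_X_pow_le (r : F[X][X]) :
    ∃ c : ℕ, ∀ N, (r.eval (X ^ N)).natDegree ≤ c + N * r.natDegree := by
  refine ⟨(Finset.range (r.natDegree + 1)).sup fun i => (r.coeff i).natDegree, fun N => ?_⟩
  rw [eval_eq_sum_range]
  refine natDegree_sum_le_of_forall_le _ _ fun i hi => ?_
  refine natDegree_mul_le.trans (add_le_add ?_ ?_)
  · exact Finset.le_sup (f := fun i => (r.coeff i).natDegree) hi
  · rw [← pow_mul, natDegree_X_pow]
    exact Nat.mul_le_mul_left _ (Nat.lt_succ_iff.1 (Finset.mem_range.1 hi))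

theorem exists_natDegree_eval_X_pow_eq {Q : F[X][X]} (hQ : Q.Monic) :
    ∃ c : ℕ, ∀ N, c < N → (Q.eval (X ^ N)).natDegree = N * Q.natDegree := by
  rcases Nat.eq_zero_or_pos Q.natDegree with h0 | hpos
  · refine ⟨0, fun N _ => ?_⟩
    rw [h0, (Monic.natDegree_eq_zero hQ).1 h0]
    simp
  obtain ⟨c, hc⟩ := exists_natDegree_eval_X_pow_le Q.eraseLead
  refine ⟨c, fun N hN => ?_⟩
  have h1 := Q.eraseLead_add_C_mul_X_pow
  rw [hQ.leadingCoeff, map_one, one_mul] at h1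
  have h2 : Q.eval (X ^ N) = Q.eraseLead.eval (X ^ N) + X ^ (N * Q.natDegree) := by
    conv_lhs => rw [← h1]
    rw [eval_add, eval_pow, eval_X, pow_mul]
  rw [h2, natDegree_add_eq_right_of_natDegree_lt, natDegree_X_pow]
  rw [natDegree_X_pow]
  refine (hc N).trans_lt ?_
  have h3 : Q.eraseLead.natDegree ≤ Q.natDegree - 1 := eraseLead_natDegree_le Q
  calc c + N * Q.eraseLead.natDegree ≤ c + N * (Q.natDegree - 1) := by gcongr
    _ < N + N * (Q.natDegree - 1) := by omega
    _ = N * Q.natDegree := by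
      obtain ⟨t, ht⟩ := Nat.exists_eq_succ_of_ne_zero hpos.ne'
      rw [ht, Nat.succ_sub_one, Nat.mul_succ, add_comm]

theorem card_pow_injective (R : Type*) [CommRing R] [Nontrivial R] :
    Function.Injective fun n : ℕ => (X : R[X]) ^ (Fintype.card F ^ n) := by
  intro a b h
  have h1 := congrArg natDegree h
  simp only [natDegree_X_pow] at h1
  exact Nat.pow_right_injective (Fintype.one_lt_card (α := F)) h1

/-- For N = q^n large, Q(θ^N) has degree N deg Q in θ, which exceeds the bound c' + N deg r for
r(θ^N). Divisibility then forces r(θ^N) = 0 at infinitely many points. -/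
theorem eq_zero_of_forall_eval_dvd {Q r : F[X][X]} (hQ : Q.Monic)
    (hdeg : r.natDegree < Q.natDegree)
    (h : ∀ n : ℕ, Q.eval (X ^ (Fintype.card F ^ n)) ∣ r.eval (X ^ (Fintype.card F ^ n))) :
    r = 0 := by
  obtain ⟨c, hc⟩ := exists_natDegree_eval_X_pow_eq hQ
  obtain ⟨c', hc'⟩ := exists_natDegree_eval_X_pow_le r
  have hq : 1 < Fintype.card F := Fintype.one_lt_card
  refine eq_zero_of_infinite_isRoot r (Set.Infinite.mono ?_
    (Set.infinite_range_of_injective ((card_pow_injective (F := F) F).comp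
      (add_left_injective (c + c')))))
  rintro _ ⟨n, rfl⟩
  have hN : c + c' < Fintype.card F ^ (n + (c + c')) :=
    (Nat.le_add_left _ _).trans_lt (Nat.lt_pow_self hq)
  simp only [Function.comp_apply, Set.mem_ofPred_eq, IsRoot.def]
  generalize hM : n + (c + c') = M at hN
  by_contra h0
  have h1 := natDegree_le_of_dvd (h M) h0
  rw [hc _ (by omega)] at h1
  have h2 := h1.trans (hc' _)
  generalize Fintype.card F ^ M = N at hN h2
  have h3 : N * (r.natDegree + 1) ≤ N * Q.natDegree := Nat.mul_le_mul_left _ hdeg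
  rw [mul_add] at h3
  omega

/-- The remainder of `P` modulo `Q` inherits the divisibility of its values;
`eq_zero_of_forall_eval_dvd` is applied to the coefficient of each monomial in the t_j. -/
theorem exists_eq_map_mul {s : ℕ} {Q : F[X][X]} (hQ : Q.Monic)
    (P : (MvPolynomial (Fin s) F[X])[X]) (h : ∀ n : ℕ, ∃ g : MvPolynomial (Fin s) F[X],
      MvPolynomial.C (Q.eval (X ^ (Fintype.card F ^ n))) * g =
        P.eval (MvPolynomial.C (X ^ (Fintype.card F ^ n)))) :
    ∃ H, P = Q.map MvPolynomial.C * H := by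
  rcases Nat.eq_zero_or_pos Q.natDegree with h0 | hpos
  · rw [(Monic.natDegree_eq_zero hQ).1 h0]
    exact ⟨P, by simp⟩
  have hQm : (Q.map (MvPolynomial.C : F[X] →+* MvPolynomial (Fin s) F[X])).Monic := hQ.map _
  refine ⟨P /ₘ Q.map MvPolynomial.C, ?_⟩
  have hdiv := modByMonic_add_div P (Q.map (MvPolynomial.C : F[X] →+* MvPolynomial (Fin s) F[X]))
  suffices hR : P %ₘ Q.map MvPolynomial.C = 0 by
    rw [hR, zero_add] at hdiv
    exact hdiv.symm
  set R := P %ₘ Q.map MvPolynomial.C with hRdef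
  have hRdeg : R.natDegree < Q.natDegree := by
    have h1 := natDegree_modByMonic_lt P hQm (fun h1 => by
      have := hQ.natDegree_map (MvPolynomial.C : F[X] →+* MvPolynomial (Fin s) F[X])
      rw [h1, natDegree_one] at this
      omega)
    rwa [hQ.natDegree_map] at h1
  have key : ∀ e : Fin s →₀ ℕ, ∑ i ∈ Finset.range Q.natDegree,
      C (MvPolynomial.coeff e (R.coeff i)) * X ^ i = 0 := by
    intro e
    refine eq_zero_of_forall_eval_dvd hQ ?_ fun n => ?_
    · refine (natDegree_sum_le_of_forall_le (n := Q.natDegree - 1) _ _ fun i hi => ?_).trans_lt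
        (by omega)
      have := Finset.mem_range.1 hi
      exact (natDegree_C_mul_X_pow_le _ _).trans (by omega)
    · obtain ⟨g, hg⟩ := h n
      have h2 : R.eval (MvPolynomial.C (X ^ (Fintype.card F ^ n))) =
          MvPolynomial.C (Q.eval (X ^ (Fintype.card F ^ n))) * (g - (P /ₘ Q.map MvPolynomial.C).eval
            (MvPolynomial.C (X ^ (Fintype.card F ^ n)))) := by
        rw [mul_sub, hg, eq_sub_iff_add_eq, ← eval₂_at_apply, ← eval_map, ← eval_mul, ← eval_add,
          hdiv]
      have h3 := congrArg (MvPolynomial.coeff e) h2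
      rw [MvPolynomial.coeff_C_mul, eval_eq_sum_range' hRdeg, MvPolynomial.coeff_sum] at h3
      refine ⟨_, Eq.trans ?_ h3⟩
      rw [eval_finsetSum]
      refine Finset.sum_congr rfl fun i _ => ?_
      rw [eval_mul, eval_C, eval_pow, eval_X, ← map_pow, mul_comm (R.coeff i),
        MvPolynomial.coeff_C_mul, mul_comm]
  refine Polynomial.ext fun i => MvPolynomial.ext _ _ fun e => ?_
  rw [coeff_zero, MvPolynomial.coeff_zero]
  by_cases hi : i < Q.natDegree
  · have h4 := congrArg (fun p => p.coeff i) (key e)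
    simpa [finsetSum_coeff, coeff_C_mul, coeff_X_pow, hi] using h4
  · rw [coeff_eq_zero_of_natDegree_lt (by omega), MvPolynomial.coeff_zero]

theorem eval_interpDenom_ne_zero (n m : ℕ) :
    (interpDenom F m).eval (X ^ (Fintype.card F ^ n)) ≠ 0 := by
  rw [interpDenom, eval_prod, Finset.prod_ne_zero_iff]
  refine fun k _ => ?_
  rw [← coe_evalRingHom, map_addDenom]
  simp only [coe_evalRingHom, eval_genericBracket]
  clear * -
  induction k with
  | zero => exact one_ne_zero
  | succ k ih => exact mul_ne_zero (bracket_ne_zero (Nat.succ_ne_zero _)) (pow_ne_zero _ ih)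

theorem exists_interpolates {s m : ℕ} (hs : s = (Fintype.card F - 1) * m + 1) (hm : m ≠ 0)
    (hmi : mIndex F s = m) :
    ∃ H : Polynomial (MvPolynomial (Fin s) F[X]), Interpolates H := by
  have hs1 : 1 < s := by
    have hq : Fintype.card F - 1 ≠ 0 := by
      have := Fintype.one_lt_card (α := F)
      omega
    have := mul_ne_zero hq hm
    omega
  have hval : ∀ n : ℕ, ∃ g : MvPolynomial (Fin s) F[X],
      MvPolynomial.C ((interpDenom F m ^ s).eval (X ^ (Fintype.card F ^ n))) * g =
        (interpNumer (MvPolynomial.C : F[X] →+* MvPolynomial (Fin s) F[X]) MvPolynomial.X m).eval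
          (MvPolynomial.C (X ^ (Fintype.card F ^ n))) ∧
      harmonicSum F s 1 (n + m) = bigPi F s (n + m) * polyAToK F s g := by
    intro n
    obtain ⟨e, he0, he, hH⟩ := exists_harmonicSum_eq_bigPi_mul (n := n) hs hm hmi
    exact ⟨_, interpDenom_mul_eq_interpNumer
      (ι := (MvPolynomial.C : F[X] →+* MvPolynomial (Fin s) F[X])) (x := MvPolynomial.X)
      hs1 he0 he, hH⟩
  obtain ⟨H, hH⟩ := exists_eq_map_mul ((interpDenom_monic F m).pow s)
    (interpNumer (MvPolynomial.C : F[X] →+* MvPolynomial (Fin s) F[X]) MvPolynomial.X m)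
    (fun n => (hval n).imp fun g hg => hg.1)
  refine ⟨H, fun d hd => ?_⟩
  rw [hmi] at hd ⊢
  obtain ⟨n, rfl⟩ := Nat.exists_eq_add_of_le' hd
  obtain ⟨g, hg1, hg2⟩ := hval n
  rw [Nat.add_sub_cancel, hg2]
  congr 2
  rw [hH, eval_mul, eval_map, eval₂_at_apply] at hg1
  refine mul_left_cancel₀ ?_ hg1
  rw [Ne, MvPolynomial.C_eq_zero, eval_pow]
  exact pow_ne_zero _ (eval_interpDenom_ne_zero n m)

theorem polyAToK_injective (s : ℕ) : Function.Injective (polyAToK F s) :=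
  MvPolynomial.map_injective _ (RatFunc.algebraMap_injective F)

theorem bigPi_ne_zero (s d : ℕ) : bigPi F s d ≠ 0 := by
  refine mul_ne_zero ?_ (Finset.prod_ne_zero_iff.2 fun j _ => ?_)
  · rw [Ne, MvPolynomial.C_eq_zero, inv_eq_zero,
      map_eq_zero_iff _ (RatFunc.algebraMap_injective F)]
    exact carlitzL_ne_zero _
  · rw [Ne, map_eq_zero_iff _ (polyAToK_injective s), carlitzB, Finset.prod_eq_zero_iff]
    rintro ⟨k, _, hk⟩
    rw [sub_eq_zero] at hk
    have := congrArg MvPolynomial.totalDegree hk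
    rw [MvPolynomial.totalDegree_X, MvPolynomial.totalDegree_C] at this
    exact one_ne_zero this

theorem Interpolates.unique {s : ℕ} {H H' : Polynomial (MvPolynomial (Fin s) F[X])}
    (hH : Interpolates H) (hH' : Interpolates H') : H = H' := by
  refine eq_of_infinite_eval_eq _ _ (Set.Infinite.mono ?_ (Set.infinite_range_of_injective
    ((MvPolynomial.C_injective (Fin s) F[X]).comp (card_pow_injective (F := F) F))))
  rintro _ ⟨n, rfl⟩
  have h1 := hH (n + mIndex F s) (Nat.le_add_left _ _)
  have h2 := hH' (n + mIndex F s) (Nat.le_add_left _ _)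
  rw [h1, Nat.add_sub_cancel] at h2
  exact polyAToK_injective s (mul_left_cancel₀ (bigPi_ne_zero _ _) h2)

end

section

/-! ### Infinite products in ultrametric rings -/

section Products

variable {R : Type*} [NormedCommRing R] [NormOneClass R] [IsUltrametricDist R]

theorem norm_prod_one_add_sub_one_le {ι : Type*} (S : Finset ι) {x : ι → R} {c : ℝ} (hc0 : 0 ≤ c)
    (hc1 : c ≤ 1) (hx : ∀ i, ‖x i‖ ≤ c) : ‖∏ i ∈ S, (1 + x i) - 1‖ ≤ c := by
  classical
  induction S using Finset.induction_on with
  | empty => simpa using hc0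
  | insert i S hi ih =>
    have h1 : ‖∏ i ∈ S, (1 + x i)‖ ≤ 1 := by
      have := IsUltrametricDist.norm_add_le_max (∏ i ∈ S, (1 + x i) - 1) 1
      rw [sub_add_cancel, norm_one] at this
      exact this.trans (max_le (ih.trans hc1) le_rfl)
    have h2 : ∏ i ∈ insert i S, (1 + x i) - 1 =
        (∏ i ∈ S, (1 + x i) - 1) + x i * ∏ i ∈ S, (1 + x i) := by
      rw [Finset.prod_insert hi]
      ring
    rw [h2]
    refine (IsUltrametricDist.norm_add_le_max _ _).trans (max_le ih ?_)
    refine (norm_mul_le _ _).trans ?_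
    calc ‖x i‖ * ‖∏ i ∈ S, (1 + x i)‖ ≤ c * 1 := by
          exact mul_le_mul (hx i) h1 (norm_nonneg _) hc0
      _ = c := mul_one c

variable [CompleteSpace R]

theorem norm_tprod_one_sub_sub_one_le {ι : Type*} {x : ι → R} {c : ℝ} (hc0 : 0 ≤ c)
    (hc1 : c ≤ 1) (hx : ∀ i, ‖x i‖ ≤ c) (hs : Summable fun i => ‖x i‖) :
    ‖∏' i, (1 - x i) - 1‖ ≤ c := by
  have hs' : Summable fun i => ‖-x i‖ := by simpa only [norm_neg] using hs
  have h := (multipliable_one_add_of_summable hs').hasProd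
  simp only [← sub_eq_add_neg] at h
  refine le_of_tendsto ((h.sub_const 1).norm) (Eventually.of_forall fun S => ?_)
  have := norm_prod_one_add_sub_one_le S (x := fun i => -x i) hc0 hc1 (by simpa using hx)
  simpa only [← sub_eq_add_neg] using this

theorem multipliable_one_sub {ι : Type*} {x : ι → R} (hs : Summable fun i => ‖x i‖) :
    Multipliable fun i => 1 - x i := by
  have hs' : Summable fun i => ‖-x i‖ := by simpa only [norm_neg] using hs
  simpa only [← sub_eq_add_neg] using multipliable_one_add_of_summable hs'

/-- The inverse y satisfies y = 1 + xy, so ‖y‖ > 1 would contradict the ultrametric inequality. -/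
theorem norm_inverse_one_sub_le {x : R} (hx : ‖x‖ < 1) : ‖Ring.inverse (1 - x)‖ ≤ 1 := by
  have h1 : (1 - x) * Ring.inverse (1 - x) = 1 :=
    Ring.mul_inverse_cancel _ (isUnit_one_sub_of_norm_lt_one hx)
  have h2 : Ring.inverse (1 - x) = 1 + x * Ring.inverse (1 - x) := by
    linear_combination h1
  by_contra! h
  have h3 : ‖Ring.inverse (1 - x)‖ ≤ max 1 (‖x‖ * ‖Ring.inverse (1 - x)‖) := by
    conv_lhs => rw [h2]
    refine (IsUltrametricDist.norm_add_le_max _ _).trans ?_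
    rw [norm_one]
    exact max_le_max le_rfl (norm_mul_le _ _)
  rcases le_max_iff.1 h3 with h4 | h4
  · linarith
  · nlinarith

theorem tprod_mul_tprod_inverse {ι : Type*} {x : ι → R} (hx : ∀ i, ‖x i‖ < 1)
    (hs : Summable fun i => ‖x i‖) :
    (∏' i, (1 - x i)) * ∏' i, Ring.inverse (1 - x i) = 1 := by
  have h1 : ∀ i, (1 - x i) * Ring.inverse (1 - x i) = 1 := fun i =>
    Ring.mul_inverse_cancel _ (isUnit_one_sub_of_norm_lt_one (hx i))
  have h2 : ∀ i, Ring.inverse (1 - x i) = 1 + x i * Ring.inverse (1 - x i) := fun i => by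
    linear_combination h1 i
  have h3 : Multipliable fun i => Ring.inverse (1 - x i) := by
    rw [funext h2]
    refine multipliable_one_add_of_summable (hs.of_nonneg_of_le (fun i => norm_nonneg _) fun i => ?_)
    refine (norm_mul_le _ _).trans ?_
    exact mul_le_of_le_one_right (norm_nonneg _) (norm_inverse_one_sub_le (hx i))
  rw [← (multipliable_one_sub hs).tprod_mul h3]
  simp only [h1, tprod_one]

end Products

/-! ### The Tate algebra as a complete ultrametric ring -/

variable {F : Type*} [Field F] [Fintype F] {s : ℕ}

namespace Tate

/-- The coefficients of an element of the Tate algebra. -/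
def coeff (n : Fin s →₀ ℕ) (f : Tate F s) : CInfty F := MvPowerSeries.coeff n f.toSeries

theorem coeff_sub (n : Fin s →₀ ℕ) (f g : Tate F s) : coeff n (f - g) = coeff n f - coeff n g :=
  rfl

theorem coeff_add (n : Fin s →₀ ℕ) (f g : Tate F s) : coeff n (f + g) = coeff n f + coeff n g :=
  rfl

theorem norm_coeff_le (n : Fin s →₀ ℕ) (f : Tate F s) : ‖coeff n f‖ ≤ ‖f‖ := by
  have h := f.hasGaussNorm
  rw [Tate.norm_eq]
  refine le_ciSup (f := fun n => ‖MvPowerSeries.coeff n f.toSeries‖) ?_ n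
  simpa [MvPowerSeries.HasGaussNorm] using h

theorem norm_le_of_forall_coeff {f : Tate F s} {c : ℝ} (h : ∀ n, ‖coeff n f‖ ≤ c) : ‖f‖ ≤ c := by
  rw [Tate.norm_eq]
  exact ciSup_le h

theorem tendsto_coeff (f : Tate F s) :
    Tendsto (fun n => ‖coeff n f‖) cofinite (𝓝 0) := by
  have h : Tendsto (fun t => ‖MvPowerSeries.coeff t f.toSeries‖ * t.prod fun _ k => (1 : ℝ) ^ k)
    cofinite (𝓝 0) := f.2
  simp only [one_pow, Finsupp.prod, Finset.prod_const_one, mul_one] at h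
  exact h

theorem exists_coeff_eq {c : (Fin s →₀ ℕ) → CInfty F}
    (h : Tendsto (fun n => ‖c n‖) cofinite (𝓝 0)) : ∃ f : Tate F s, ∀ n, coeff n f = c n :=
  ⟨⟨c, by
    change Tendsto (fun t => ‖c t‖ * t.prod fun _ k => (1 : ℝ) ^ k) cofinite (𝓝 0)
    simpa using h⟩, fun n => rfl⟩

theorem coeff_ofPoly (n : Fin s →₀ ℕ) (p : MvPolynomial (Fin s) (CInfty F)) :
    coeff n (ofPoly F s p) = MvPolynomial.coeff n p := MvPolynomial.coeff_coe p n

theorem ofPoly_injective : Function.Injective (ofPoly F s) := fun p p' h =>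
  MvPolynomial.ext _ _ fun n => by rw [← coeff_ofPoly, h, coeff_ofPoly]

instance isUltrametricDist : IsUltrametricDist (Tate F s) :=
  IsUltrametricDist.isUltrametricDist_of_forall_norm_add_le_max_norm fun f g =>
    norm_le_of_forall_coeff fun n => by
      rw [coeff_add]
      exact (IsUltrametricDist.norm_add_le_max _ _).trans
        (max_le_max (norm_coeff_le n f) (norm_coeff_le n g))

theorem norm_const (c : CInfty F) : ‖const F s c‖ = ‖c‖ := by
  classical
  have h : ∀ n, coeff n (const F s c) = if 0 = n then c else 0 := fun n => by
    rw [const, RingHom.comp_apply, coeff_ofPoly, MvPolynomial.coeff_C]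
  refine le_antisymm (norm_le_of_forall_coeff fun n => ?_) ?_
  · rw [h]
    split_ifs
    · exact le_rfl
    · rw [norm_zero]; exact norm_nonneg c
  · have := norm_coeff_le 0 (const F s c)
    rwa [h, if_pos rfl] at this

instance normOneClass : NormOneClass (Tate F s) :=
  ⟨by rw [← map_one (const F s), norm_const, norm_one]⟩

theorem continuous_const : Continuous (const F s) :=
  (AddMonoidHomClass.isometry_of_norm (const F s) norm_const).continuous

theorem norm_ofPoly_X_le (j : Fin s) : ‖ofPoly F s (MvPolynomial.X j)‖ ≤ 1 := by
  classical
  refine norm_le_of_forall_coeff fun n => ?_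
  rw [coeff_ofPoly, MvPolynomial.coeff_X]
  split_ifs <;> simp

instance completeSpace : CompleteSpace (Tate F s) := by
  refine Metric.complete_of_cauchySeq_tendsto fun u hu => ?_
  have hu' := Metric.cauchySeq_iff.1 hu
  have hc : ∀ n, CauchySeq fun k => coeff n (u k) := fun n => by
    refine Metric.cauchySeq_iff.2 fun ε hε => ?_
    obtain ⟨N, hN⟩ := hu' ε hε
    refine ⟨N, fun a ha b hb => ?_⟩
    rw [dist_eq_norm, ← coeff_sub]
    refine (norm_coeff_le _ _).trans_lt ?_
    rw [← dist_eq_norm]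
    exact hN a ha b hb
  choose c hlim using fun n => cauchySeq_tendsto_of_complete (hc n)
  -- Convergence is uniform over the coefficients; this is what makes the limiting coefficients tend
  -- to zero.
  have hunif : ∀ ε > 0, ∃ N, ∀ k ≥ N, ∀ n, ‖coeff n (u k) - c n‖ ≤ ε := by
    intro ε hε
    obtain ⟨N, hN⟩ := hu' ε hε
    refine ⟨N, fun k hk n => ?_⟩
    refine le_of_tendsto ((hlim n).const_sub (coeff n (u k))).norm
      ((eventually_ge_atTop N).mono fun b hb => ?_)
    rw [← coeff_sub]
    refine (norm_coeff_le _ _).trans ?_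
    rw [← dist_eq_norm]
    exact (hN k hk b hb).le
  have hc0 : Tendsto (fun n => ‖c n‖) cofinite (𝓝 0) := by
    rw [Metric.tendsto_nhds]
    intro ε hε
    obtain ⟨N, hN⟩ := hunif (ε / 2) (half_pos hε)
    filter_upwards [Metric.tendsto_nhds.1 (tendsto_coeff (u N)) (ε / 2) (half_pos hε)] with n hn
    rw [dist_zero_right, norm_norm] at hn ⊢
    have h1 := hN N le_rfl n
    have h2 := norm_sub_norm_le (c n) (coeff n (u N))
    rw [norm_sub_rev] at h2
    linarith
  obtain ⟨f, hf⟩ := exists_coeff_eq hc0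
  refine ⟨f, Metric.tendsto_atTop.2 fun ε hε => ?_⟩
  obtain ⟨N, hN⟩ := hunif (ε / 2) (half_pos hε)
  refine ⟨N, fun k hk => ?_⟩
  rw [dist_eq_norm]
  refine (norm_le_of_forall_coeff (c := ε / 2) fun n => ?_).trans_lt (half_lt_self hε)
  rw [coeff_sub, hf]
  exact hN k hk n

end Tate

/-! ### Absolute values of polynomials in `θ` -/

theorem norm_ofK (x : RatFunc F) :
    ‖ofK F x‖ = ‖(algebraMap (RatFunc F) (KInfty F) x : KInfty F)‖ := by
  have h : ofK F x = ((algebraMap (KInfty F) (KInftyAlg F) (algebraMap (RatFunc F) (KInfty F) x) :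
      KInftyAlg F) : CInfty F) := rfl
  rw [h, UniformSpace.Completion.norm_coe]
  exact spectralNorm_extends _

theorem one_lt_norm_theta : 1 < ‖theta F‖ := by
  rw [theta, norm_ofK]
  refine Valued.toNormedField.one_lt_norm_iff.2 ?_
  have h : Valued.v (algebraMap (RatFunc F) (KInfty F) RatFunc.X) = WithZero.exp (1 : ℤ) := by
    let _ := @RatFunc.inftyValued F _ (Classical.decEq _)
    refine (Valued.extensionValuation_apply_coe (K := RatFunc F) RatFunc.X).trans ?_
    exact @RatFunc.inftyValuation.X F _ (Classical.decEq _)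
  rw [h, ← WithZero.exp_zero, WithZero.exp_lt_exp]
  exact one_pos

variable (F) in
/-- The embedding of `A = F[θ]` into `ℂ_∞`. -/
def ofA : F[X] →+* CInfty F := (ofK F).comp (algebraMap F[X] (RatFunc F))

theorem ofA_X : ofA F X = theta F := by
  rw [ofA, RingHom.comp_apply, RatFunc.algebraMap_X, theta]

theorem norm_ofA_C_le (x : F) : ‖ofA F (C x)‖ ≤ 1 := by
  rcases eq_or_ne x 0 with rfl | hx
  · simp
  · have h := congrArg (fun a => ‖ofA F (C a)‖) (FiniteField.pow_card_sub_one_eq_one x hx)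
    simp only [map_pow, norm_pow, map_one, norm_one] at h
    refine ((pow_eq_one_iff_of_nonneg (norm_nonneg _) ?_).1 h).le
    have := Fintype.one_lt_card (α := F)
    omega

theorem norm_ofA_le {a : F[X]} {d : ℕ} (h : a.natDegree ≤ d) : ‖ofA F a‖ ≤ ‖theta F‖ ^ d := by
  rw [a.as_sum_range_C_mul_X_pow, map_sum]
  refine IsUltrametricDist.norm_sum_le_of_forall_le_of_nonneg (pow_nonneg (norm_nonneg _) d)
    fun i hi => ?_
  rw [map_mul, map_pow, ofA_X, norm_mul, norm_pow]
  refine (mul_le_of_le_one_left (pow_nonneg (norm_nonneg _) i) (norm_ofA_C_le _)).trans ?_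
  refine pow_le_pow_right₀ one_lt_norm_theta.le ?_
  have := Finset.mem_range.1 hi
  omega

theorem norm_ofA_of_monic {a : F[X]} (ha : a.Monic) : ‖ofA F a‖ = ‖theta F‖ ^ a.natDegree := by
  rcases Nat.eq_zero_or_pos a.natDegree with h0 | hpos
  · rw [h0, ha.natDegree_eq_zero.1 h0]
    simp
  have h1 := a.eraseLead_add_C_mul_X_pow
  rw [ha.leadingCoeff, map_one, one_mul] at h1
  have h2 : ‖ofA F a.eraseLead‖ < ‖theta F‖ ^ a.natDegree :=
    (norm_ofA_le (eraseLead_natDegree_le a)).trans_lt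
      (pow_lt_pow_right₀ one_lt_norm_theta (by omega))
  have h3 : ofA F a = ofA F a.eraseLead + theta F ^ a.natDegree := by
    conv_lhs => rw [← h1]
    rw [map_add, map_pow, ofA_X]
  rw [h3, IsUltrametricDist.norm_add_eq_max_of_norm_ne_norm (by rw [norm_pow]; exact h2.ne),
    norm_pow, max_eq_right h2.le]

end

section

/-! ### Asymptotics of the tails of the products -/

section Tails

theorem tendsto_mul_mul_sub_one {R : Type*} [NormedCommRing R] {y a b : ℕ → R} {α β : R}
    (ha : Tendsto (fun n => y n * (a n - 1)) atTop (𝓝 α)) (hb1 : Tendsto b atTop (𝓝 1))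
    (hb : Tendsto (fun n => y n * (b n - 1)) atTop (𝓝 β)) :
    Tendsto (fun n => y n * (a n * b n - 1)) atTop (𝓝 (α + β)) := by
  have h := (ha.mul hb1).add hb
  rw [mul_one] at h
  refine h.congr fun n => ?_
  ring

theorem tendsto_mul_prod_sub_one {R ι : Type*} [NormedCommRing R] {y : ℕ → R} {a : ι → ℕ → R}
    {α : ι → R} (S : Finset ι)
    (ha : ∀ i, Tendsto (fun n => y n * (a i n - 1)) atTop (𝓝 (α i)))
    (ha1 : ∀ i, Tendsto (a i) atTop (𝓝 1)) :
    Tendsto (fun n => y n * (∏ i ∈ S, a i n - 1)) atTop (𝓝 (∑ i ∈ S, α i)) := by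
  classical
  induction S using Finset.induction_on with
  | empty => simp
  | insert i S hi ih =>
    simp only [Finset.prod_insert hi, Finset.sum_insert hi]
    refine tendsto_mul_mul_sub_one (ha i) ?_ ih
    have := tendsto_finsetProd S fun i _ => ha1 i
    simpa using this

variable {R : Type*} [NormedCommRing R] [NormOneClass R] [IsUltrametricDist R] [CompleteSpace R]
  {x : ℕ → R} {r : ℕ → ℝ}

theorem norm_tprod_tail_sub_one_le (hr : Antitone r) (hr0 : ∀ n, 0 ≤ r n) (hr1 : ∀ n, r n ≤ 1)
    (hrs : Summable r) (hx : ∀ n, ‖x n‖ ≤ r n) (n : ℕ) :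
    ‖∏' i, (1 - x (i + n)) - 1‖ ≤ r n :=
  norm_tprod_one_sub_sub_one_le (hr0 n) (hr1 n)
    (fun i => (hx _).trans (hr (Nat.le_add_left n i)))
    (((summable_nat_add_iff n).2 hrs).of_nonneg_of_le (fun _ => norm_nonneg _) fun _ => hx _)

theorem tendsto_tprod_tail (hr : Antitone r) (hr0 : ∀ n, 0 ≤ r n) (hr1 : ∀ n, r n ≤ 1)
    (hrs : Summable r) (hx : ∀ n, ‖x n‖ ≤ r n) :
    Tendsto (fun n => ∏' i, (1 - x (i + n))) atTop (𝓝 1) := by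
  rw [tendsto_iff_norm_sub_tendsto_zero]
  exact squeeze_zero (fun n => norm_nonneg _)
    (fun n => norm_tprod_tail_sub_one_le hr hr0 hr1 hrs hx n) hrs.tendsto_atTop_zero

theorem multipliable_one_sub_nat_add (hrs : Summable r) (hx : ∀ n, ‖x n‖ ≤ r n) (n : ℕ) :
    Multipliable fun i => 1 - x (i + n) :=
  multipliable_one_sub
    (((summable_nat_add_iff n).2 hrs).of_nonneg_of_le (fun _ => norm_nonneg _) fun _ => hx _)

theorem prod_mul_tprod_tail (hrs : Summable r) (hx : ∀ n, ‖x n‖ ≤ r n) (n : ℕ) :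
    (∏ i ∈ Finset.range n, (1 - x i)) * ∏' i, (1 - x (i + n)) = ∏' i, (1 - x i) :=
  Multipliable.prod_mul_tprod_nat_mul' (f := fun i => 1 - x i)
    (multipliable_one_sub_nat_add hrs hx n)

/-- Only the first factor of the tail matters: with E_{n+1} the tail from n + 1 on, the expression
is y_n(E_{n+1} - 1) - (y_n x_n) E_{n+1}. -/
theorem tendsto_mul_tprod_tail_sub_one (hr : Antitone r) (hr0 : ∀ n, 0 ≤ r n)
    (hr1 : ∀ n, r n ≤ 1) (hrs : Summable r) (hx : ∀ n, ‖x n‖ ≤ r n) {y : ℕ → R} {t : R}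
    (hy : ∀ n, y n * x n = t) (hyr : Tendsto (fun n => ‖y n‖ * r (n + 1)) atTop (𝓝 0)) :
    Tendsto (fun n => y n * (∏' i, (1 - x (i + n)) - 1)) atTop (𝓝 (-t)) := by
  have hE := (tendsto_add_atTop_iff_nat 1).2 (tendsto_tprod_tail hr hr0 hr1 hrs hx)
  have h1 : Tendsto (fun n => y n * (∏' i, (1 - x (i + (n + 1))) - 1)) atTop (𝓝 0) :=
    squeeze_zero_norm (fun n => (norm_mul_le _ _).trans (mul_le_mul_of_nonneg_left
      (norm_tprod_tail_sub_one_le hr hr0 hr1 hrs hx (n + 1)) (norm_nonneg _))) hyr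
  have h2 := h1.sub (hE.const_mul t)
  rw [mul_one, zero_sub] at h2
  refine h2.congr fun n => ?_
  have h3 := prod_mul_tprod_tail (x := fun i => x (i + n)) (r := fun i => r (i + n))
    ((summable_nat_add_iff n).2 hrs) (fun i => hx _) 1
  rw [Finset.prod_range_one, zero_add] at h3
  have h4 : ∀ i, i + 1 + n = i + (n + 1) := fun i => by ring
  simp only [h4] at h3
  rw [← h3, ← hy n]
  ring

end Tails

variable {F : Type*} [Field F] [Fintype F] {s : ℕ}

variable (F) in
/-- `|θ|^(-q^n)`. -/
def thetaDecay (n : ℕ) : ℝ := (‖theta F‖ ^ (Fintype.card F ^ n))⁻¹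

theorem thetaDecay_nonneg (n : ℕ) : 0 ≤ thetaDecay F n :=
  inv_nonneg.2 (pow_nonneg (norm_nonneg _) _)

theorem thetaDecay_antitone : Antitone (thetaDecay F) := fun a b h => by
  have h1 := one_lt_norm_theta (F := F)
  refine inv_anti₀ (by positivity) (pow_le_pow_right₀ h1.le ?_)
  exact Nat.pow_le_pow_right Fintype.card_pos h

theorem thetaDecay_le_pow (n : ℕ) : thetaDecay F n ≤ (‖theta F‖⁻¹) ^ n := by
  have h1 := one_lt_norm_theta (F := F)
  rw [thetaDecay, inv_pow]
  exact inv_anti₀ (by positivity)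
    (pow_le_pow_right₀ h1.le (Nat.lt_pow_self Fintype.one_lt_card).le)

theorem thetaDecay_lt_one (n : ℕ) : thetaDecay F n < 1 := by
  have h1 := one_lt_norm_theta (F := F)
  exact inv_lt_one_of_one_lt₀ (one_lt_pow₀ h1 (pow_ne_zero _ Fintype.card_ne_zero))

theorem summable_pow_inv_norm_theta : Summable fun n : ℕ => (‖theta F‖⁻¹) ^ n :=
  summable_geometric_of_lt_one (inv_nonneg.2 (norm_nonneg _))
    (inv_lt_one_of_one_lt₀ one_lt_norm_theta)

theorem summable_thetaDecay : Summable (thetaDecay F) :=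
  summable_pow_inv_norm_theta.of_nonneg_of_le thetaDecay_nonneg thetaDecay_le_pow

theorem theta_ne_zero : theta F ≠ 0 := norm_pos_iff.1 (one_pos.trans one_lt_norm_theta)

theorem tendsto_norm_theta_pow_mul_thetaDecay :
    Tendsto (fun n => ‖theta F ^ (Fintype.card F ^ n)‖ * thetaDecay F (n + 1)) atTop (𝓝 0) := by
  have h1 := one_lt_norm_theta (F := F)
  refine squeeze_zero (fun n => mul_nonneg (norm_nonneg _) (thetaDecay_nonneg _)) (fun n => ?_)
    (summable_thetaDecay (F := F)).tendsto_atTop_zero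
  have h2 : 0 < ‖theta F‖ := by positivity
  rw [thetaDecay, thetaDecay, norm_pow, ← div_eq_mul_inv, div_le_iff₀ (by positivity),
    ← div_eq_inv_mul, le_div_iff₀ (by positivity), ← pow_add]
  refine pow_le_pow_right₀ h1.le ?_
  have := Nat.mul_le_mul_left (Fintype.card F ^ n) (Fintype.one_lt_card (α := F))
  rw [pow_succ]
  omega

/-- `t_j / θ^(q^i)`. -/
def omegaTerm (j : Fin s) (i : ℕ) : Tate F s :=
  Tate.ofPoly F s (MvPolynomial.X j) * Tate.const F s ((theta F ^ (Fintype.card F ^ i))⁻¹)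

variable (F) in
/-- `θ / θ^(q^(i+1))`. -/
def periodTerm (i : ℕ) : CInfty F := theta F / theta F ^ (Fintype.card F ^ (i + 1))

theorem norm_omegaTerm_le (j : Fin s) (i : ℕ) : ‖(omegaTerm j i : Tate F s)‖ ≤ thetaDecay F i := by
  refine (norm_mul_le _ _).trans ?_
  rw [Tate.norm_const, norm_inv, norm_pow]
  exact mul_le_of_le_one_left (thetaDecay_nonneg i) (Tate.norm_ofPoly_X_le j)

theorem norm_periodTerm_le (i : ℕ) : ‖periodTerm F i‖ ≤ thetaDecay F i := by
  have h1 := one_lt_norm_theta (F := F)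
  have h2 : 0 < ‖theta F‖ := by positivity
  rw [periodTerm, thetaDecay, norm_div, norm_pow, div_le_iff₀ (by positivity), ← div_eq_inv_mul,
    le_div_iff₀ (by positivity), ← pow_succ']
  refine pow_le_pow_right₀ h1.le ?_
  have := Nat.mul_le_mul_left (Fintype.card F ^ i) (Fintype.one_lt_card (α := F))
  have := Nat.pow_pos (n := i) (Fintype.card_pos (α := F))
  rw [pow_succ]
  omega

/-- `∏ (1 - t_j / θ^(q^i))`. -/
def omegaProd (j : Fin s) : Tate F s := ∏' i, (1 - omegaTerm j i)

variable (F) in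
/-- `∏ (1 - θ / θ^(q^i))`. -/
def periodProd : CInfty F := ∏' i, (1 - periodTerm F i)

theorem summable_norm_omegaTerm (j : Fin s) : Summable fun i => ‖(omegaTerm j i : Tate F s)‖ :=
  summable_thetaDecay.of_nonneg_of_le (fun _ => norm_nonneg _) (norm_omegaTerm_le j)

theorem summable_norm_periodTerm : Summable fun i => ‖periodTerm F i‖ :=
  summable_thetaDecay.of_nonneg_of_le (fun _ => norm_nonneg _) norm_periodTerm_le

theorem omegaProd_mul (j : Fin s) :
    omegaProd j * ∏' i, Ring.inverse (1 - (omegaTerm j i : Tate F s)) = 1 :=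
  tprod_mul_tprod_inverse (fun i => (norm_omegaTerm_le j i).trans_lt (thetaDecay_lt_one i))
    (summable_norm_omegaTerm j)

theorem periodProd_mul : periodProd F * ∏' i, (1 - periodTerm F i)⁻¹ = 1 := by
  have := tprod_mul_tprod_inverse
    (fun i => (norm_periodTerm_le (F := F) i).trans_lt (thetaDecay_lt_one i))
    summable_norm_periodTerm
  simp only [Ring.inverse_eq_inv'] at this
  exact this

theorem periodProd_ne_zero : periodProd F ≠ 0 := left_ne_zero_of_mul_eq_one periodProd_mul

theorem omegaProd_mul_omega (ϖ : CInfty F) (j : Fin s) :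
    omegaProd j * omega ϖ j = Tate.const F s ϖ := by
  have h : omega ϖ j = Tate.const F s ϖ * ∏' i, Ring.inverse (1 - (omegaTerm j i : Tate F s)) := rfl
  rw [h, mul_left_comm, omegaProd_mul, mul_one]

theorem piTilde_eq (ϖ : CInfty F) : piTilde ϖ = theta F * ϖ * (periodProd F)⁻¹ := by
  have h : piTilde ϖ = theta F * ϖ * ∏' i, (1 - periodTerm F i)⁻¹ := rfl
  rw [h, ← eq_inv_of_mul_eq_one_right periodProd_mul]

variable (F s) in
/-- The embedding of `A[t_1, …, t_s]` into the Tate algebra. -/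
def Tate.ofAPoly : MvPolynomial (Fin s) F[X] →+* Tate F s :=
  (Tate.ofKPoly F s).comp (polyAToK F s)

theorem Tate.ofKPoly_injective : Function.Injective (Tate.ofKPoly F s) :=
  Tate.ofPoly_injective.comp (MvPolynomial.map_injective _ (ofK F).injective)

theorem Tate.ofAPoly_injective : Function.Injective (Tate.ofAPoly F s) :=
  Tate.ofKPoly_injective.comp (polyAToK_injective s)

theorem Tate.ofKPoly_C (x : RatFunc F) :
    Tate.ofKPoly F s (MvPolynomial.C x) = Tate.const F s (ofK F x) := by
  rw [Tate.ofKPoly, RingHom.comp_apply, MvPolynomial.map_C]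
  rfl

theorem Tate.ofAPoly_C (a : F[X]) :
    Tate.ofAPoly F s (MvPolynomial.C a) = Tate.const F s (ofA F a) := by
  rw [Tate.ofAPoly, RingHom.comp_apply, polyAToK, MvPolynomial.map_C, Tate.ofKPoly_C]
  rfl

theorem Tate.ofAPoly_X (j : Fin s) :
    Tate.ofAPoly F s (MvPolynomial.X j) = Tate.ofPoly F s (MvPolynomial.X j) := by
  rw [Tate.ofAPoly, RingHom.comp_apply, polyAToK, MvPolynomial.map_X, Tate.ofKPoly,
    RingHom.comp_apply, MvPolynomial.map_X]

variable (F s) in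
/-- `(-θ)^(1-m) ∏ (1 - t_j / θ^(q^i)) / ∏ (1 - θ / θ^(q^i))`. -/
def periodFactor (m : ℕ) : Tate F s :=
  Tate.const F s (-theta F * ((-theta F) ^ m)⁻¹ * (periodProd F)⁻¹) * ∏ j, omegaProd j

variable (F s) in
/-- The partial products of `periodFactor`. -/
def periodFactorPartial (m n : ℕ) : Tate F s :=
  Tate.const F s (-theta F * ((-theta F) ^ m)⁻¹ *
    (∏ i ∈ Finset.range (n + m - 1), (1 - periodTerm F i))⁻¹) *
      ∏ j, ∏ i ∈ Finset.range n, (1 - omegaTerm j i)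

variable (F s) in
/-- The quotient of `periodFactor` by its partial product. -/
def periodFactorTail (m n : ℕ) : Tate F s :=
  (∏ j, ∏' i, (1 - omegaTerm j (i + n))) *
    Tate.const F s (∏' i, (1 - periodTerm F (i + (n + m - 1))))⁻¹

theorem periodFactorPartial_mul_tail (m n : ℕ) :
    periodFactorPartial F s m n * periodFactorTail F s m n = periodFactor F s m := by
  have h1 := prod_mul_tprod_tail summable_thetaDecay (norm_periodTerm_le (F := F)) (n + m - 1)
  have h2 : ∀ j : Fin s, _ := fun j =>
    prod_mul_tprod_tail summable_thetaDecay (norm_omegaTerm_le (F := F) j) n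
  rw [periodFactorPartial, periodFactorTail, periodFactor, periodProd, ← h1, mul_inv]
  simp only [omegaProd, ← h2, Finset.prod_mul_distrib, map_mul]
  ring

theorem isUnit_const {c : CInfty F} (hc : c ≠ 0) : IsUnit (Tate.const F s c) :=
  (isUnit_iff_ne_zero.2 hc).map _

theorem isUnit_omegaProd (j : Fin s) : IsUnit (omegaProd j : Tate F s) :=
  IsUnit.of_mul_eq_one _ (omegaProd_mul j)

theorem isUnit_periodFactor (m : ℕ) : IsUnit (periodFactor F s m) := by
  refine (isUnit_const ?_).mul (IsUnit.prod_univ_iff.2 isUnit_omegaProd)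
  have := theta_ne_zero (F := F)
  have := periodProd_ne_zero (F := F)
  simp_all

/-- Here ϖ^s = (-θ)^m ϖ, so ϖ cancels against the one in π̃. The sign arises because `periodFactor`
carries -θ where π̃ carries θ. -/
theorem periodMultiple_eq {ϖ : CInfty F} (hϖ : ϖ ^ (Fintype.card F - 1) = -theta F) {m : ℕ}
    (hs : s = (Fintype.card F - 1) * m + 1) (ν : MvPolynomial (Fin s) F[X]) :
    periodMultiple ϖ ν = -(periodFactor F s m * Tate.ofAPoly F s ν) := by
  have hϖ0 : ϖ ≠ 0 := by
    rintro rfl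
    rw [zero_pow (by have := Fintype.one_lt_card (α := F); omega)] at hϖ
    exact theta_ne_zero (neg_eq_zero.1 hϖ.symm)
  have h1 : (∏ j, omegaProd j) * ∏ j : Fin s, omega ϖ j = Tate.const F s (ϖ ^ s) := by
    rw [← Finset.prod_mul_distrib, Finset.prod_congr rfl fun j _ => omegaProd_mul_omega ϖ j]
    simp
  have h2 : (∏ j : Fin s, omega ϖ j) * ((∏ j, omegaProd j) * Tate.const F s (ϖ ^ s)⁻¹) = 1 := by
    rw [← mul_assoc, mul_comm (∏ j : Fin s, omega ϖ j), h1, ← map_mul,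
      mul_inv_cancel₀ (pow_ne_zero _ hϖ0), map_one]
  have h3 : Ring.inverse (∏ j : Fin s, omega ϖ j) =
      (∏ j, omegaProd j) * Tate.const F s (ϖ ^ s)⁻¹ := by
    refine (IsUnit.of_mul_eq_one _ h2).mul_left_cancel ?_
    rw [h2, Ring.mul_inverse_cancel _ (IsUnit.of_mul_eq_one _ h2)]
  have h4 : piTilde ϖ * (ϖ ^ s)⁻¹ = -(-theta F * ((-theta F) ^ m)⁻¹ * (periodProd F)⁻¹) := by
    rw [piTilde_eq, hs, pow_succ, pow_mul, hϖ, mul_inv]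
    field_simp
  rw [periodMultiple, h3, periodFactor]
  calc _ = Tate.const F s (piTilde ϖ * (ϖ ^ s)⁻¹) * (∏ j, omegaProd j) * Tate.ofAPoly F s ν := by
        rw [map_mul, Tate.ofAPoly, RingHom.comp_apply]
        ring
    _ = _ := by
        rw [h4, map_neg]
        ring

end

section

variable {F : Type*} [Field F] [Fintype F] {s : ℕ}

/-! ### The limit of `Π_{s,d}` -/

theorem neg_one_pow_card_pow {R : Type*} [CommRing R] (f : F →+* R) (i : ℕ) :
    (-1 : R) ^ (Fintype.card F ^ i) = -1 := by
  have h := congrArg f (FiniteField.pow_card_pow i (-1 : F))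
  simpa using h

theorem neg_theta_pow (i : ℕ) :
    (-theta F) ^ (Fintype.card F ^ i) = -theta F ^ (Fintype.card F ^ i) := by
  rw [neg_pow, neg_one_pow_card_pow ((ofA F).comp C), neg_one_mul]

theorem ofAPoly_carlitzB (n : ℕ) (j : Fin s) : Tate.ofAPoly F s (carlitzB F n j) =
    Tate.const F s ((-theta F) ^ ∑ i ∈ Finset.range n, Fintype.card F ^ i) *
      ∏ i ∈ Finset.range n, (1 - omegaTerm j i) := by
  rw [carlitzB, map_prod, ← Finset.prod_pow_eq_pow_sum, map_prod, ← Finset.prod_mul_distrib]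
  refine Finset.prod_congr rfl fun i _ => ?_
  have h : Tate.const F s (theta F ^ Fintype.card F ^ i) *
      Tate.const F s ((theta F ^ Fintype.card F ^ i)⁻¹) = 1 := by
    rw [← map_mul, mul_inv_cancel₀ (pow_ne_zero _ theta_ne_zero), map_one]
  rw [map_sub, Tate.ofAPoly_X, Tate.ofAPoly_C, map_pow, ofA_X, neg_theta_pow, omegaTerm, map_neg]
  linear_combination (-Tate.ofPoly F s (MvPolynomial.X j)) * h

theorem ofA_carlitzL (n : ℕ) : ofA F (carlitzL F n) =
    (-theta F) ^ (∑ i ∈ Finset.range n, Fintype.card F ^ (i + 1)) *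
      ∏ i ∈ Finset.range n, (1 - periodTerm F i) := by
  rw [carlitzL, map_prod, ← Finset.prod_pow_eq_pow_sum, ← Finset.prod_mul_distrib]
  refine Finset.prod_congr rfl fun i _ => ?_
  have h0 : theta F ^ Fintype.card F ^ (i + 1) ≠ 0 := pow_ne_zero _ theta_ne_zero
  rw [map_sub, map_pow, ofA_X, neg_theta_pow, periodTerm]
  field_simp
  ring

theorem muIndex_add {m : ℕ} (hm : mIndex F s = m) :
    muIndex F s + m = ∑ i ∈ Finset.range m, Fintype.card F ^ i := by
  have h1 : ∑ i ∈ Finset.range m, Fintype.card F ^ i =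
      (Fintype.card F ^ m - 1) / (Fintype.card F - 1) :=
    Nat.geomSum_eq Fintype.one_lt_card m
  have h2 : m ≤ ∑ i ∈ Finset.range m, Fintype.card F ^ i := by
    calc m = ∑ i ∈ Finset.range m, 1 := by simp
      _ ≤ _ := Finset.sum_le_sum fun i _ => Nat.pow_pos Fintype.card_pos
  rw [muIndex, hm, ← h1, Nat.sub_add_cancel h2]

/-- μ + m is a sum of m powers of q, each of which contributes a factor -1 as m does. -/
theorem neg_one_pow_muIndex {R : Type*} [CommRing R] (f : F →+* R) {m : ℕ}
    (hm : mIndex F s = m) : (-1 : R) ^ muIndex F s = 1 := by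
  have h1 : (-1 : R) ^ (muIndex F s + m) = (-1) ^ m := by
    rw [muIndex_add hm, ← Finset.prod_pow_eq_pow_sum,
      Finset.prod_congr rfl fun i _ => neg_one_pow_card_pow f i]
    simp
  rw [pow_add] at h1
  exact (isUnit_one.neg.pow m).mul_right_cancel (h1.trans (one_mul _).symm)

/-- Balance of the exponents of -θ in Π_{s,d} θ^(μ q^n): both sides equal Σ_{i<n+m} q^i, because
(q-1) Σ_{i<n} q^i = q^n - 1. The surplus power is (-θ)^(1-m), independent of n. -/
theorem exponent_identity {m n : ℕ} (hs : s = (Fintype.card F - 1) * m + 1) (hm0 : m ≠ 0)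
    (hm : mIndex F s = m) :
    (∑ i ∈ Finset.range n, Fintype.card F ^ i) * s + Fintype.card F ^ n * muIndex F s + m =
      1 + ∑ i ∈ Finset.range (n + m - 1), Fintype.card F ^ (i + 1) := by
  have h1 := geom_sum_card_mul_add_one (F := F) n
  have h2 := muIndex_add hm
  have h3 : 1 + ∑ i ∈ Finset.range (n + m - 1), Fintype.card F ^ (i + 1) =
      ∑ i ∈ Finset.range (n + m), Fintype.card F ^ i := by
    obtain ⟨k, hk⟩ := Nat.exists_eq_succ_of_ne_zero (by omega : n + m ≠ 0)
    rw [hk, Nat.succ_sub_one, Finset.sum_range_succ', pow_zero, add_comm]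
  rw [h3, Finset.sum_range_add]
  simp only [pow_add, ← Finset.mul_sum, ← h2]
  generalize ∑ i ∈ Finset.range n, Fintype.card F ^ i = G at *
  have h4 : G * s = (G * (Fintype.card F - 1)) * m + G := by rw [hs]; ring
  rw [h4, ← h1]
  ring

theorem ofKPoly_bigPi_mul {m : ℕ} (hs : s = (Fintype.card F - 1) * m + 1) (hm0 : m ≠ 0)
    (hm : mIndex F s = m) (n : ℕ) :
    Tate.ofKPoly F s (bigPi F s (n + m)) *
      Tate.const F s (theta F ^ (Fintype.card F ^ n)) ^ muIndex F s =
      periodFactorPartial F s m n := by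
  have h1 : ∀ j : Fin s, Tate.ofKPoly F s (polyAToK F s (carlitzB F n j)) =
      Tate.ofAPoly F s (carlitzB F n j) := fun j => rfl
  have h2 : ofK F (algebraMap F[X] (RatFunc F) (carlitzL F (n + m - 1))) =
      ofA F (carlitzL F (n + m - 1)) := rfl
  have hθ : -theta F ≠ 0 := neg_ne_zero.2 theta_ne_zero
  have h3 : theta F ^ (Fintype.card F ^ n * muIndex F s) =
      (-theta F) ^ (Fintype.card F ^ n * muIndex F s) := by
    rw [pow_mul, pow_mul, neg_theta_pow, neg_pow (theta F ^ Fintype.card F ^ n),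
      neg_one_pow_muIndex ((ofA F).comp C) hm, one_mul]
  have h4 := congrArg ((-theta F) ^ ·) (exponent_identity (n := n) hs hm0 hm)
  rw [pow_add, pow_add, pow_add, pow_one] at h4
  rw [bigPi, hm, Nat.add_sub_cancel, map_mul, map_prod, Tate.ofKPoly_C, map_inv₀, h2,
    ofA_carlitzL, periodFactorPartial]
  simp only [h1, ofAPoly_carlitzB, Finset.prod_mul_distrib, Finset.prod_const, Finset.card_univ,
    Fintype.card_fin]
  rw [← map_pow, ← map_pow, ← pow_mul, ← pow_mul, h3, mul_right_comm, ← mul_assoc, ← map_mul,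
    ← map_mul]
  congr 2
  have hg : ∀ k, (-theta F) ^ k ≠ 0 := fun k => pow_ne_zero k hθ
  rw [mul_inv, mul_right_comm _ (_⁻¹), mul_right_comm _ (_⁻¹)]
  congr 1
  rw [inv_mul_eq_div, div_mul_eq_mul_div, div_eq_iff (hg _), eq_comm, ← div_eq_mul_inv,
    div_mul_eq_mul_div, div_eq_iff (hg _), ← h4]
  ring

/-! ### Bounds for the power sums -/

theorem norm_twistedTerm_le {a : F[X]} (ha : a.Monic) :
    ‖Tate.ofKPoly F s (twistedTerm F s a)‖ ≤ (‖theta F‖⁻¹) ^ a.natDegree := by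
  have h1 : ∀ j : Fin s, ‖Tate.ofKPoly F s
      (aeval (MvPolynomial.X j : MvPolynomial (Fin s) (RatFunc F)) a)‖ ≤ 1 := by
    intro j
    rw [← polyAToK_aeval_X, aeval_eq_sum_range, map_sum, map_sum]
    refine IsUltrametricDist.norm_sum_le_of_forall_le_of_nonneg zero_le_one fun i _ => ?_
    have h2 : Tate.ofKPoly F s (polyAToK F s (a.coeff i • MvPolynomial.X j ^ i)) =
        Tate.const F s (ofA F (C (a.coeff i))) * Tate.ofPoly F s (MvPolynomial.X j) ^ i := by
      rw [← Tate.ofAPoly_X, ← Tate.ofAPoly_C, ← map_pow, ← map_mul, Algebra.smul_def]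
      rfl
    rw [h2]
    refine (norm_mul_le _ _).trans (mul_le_one₀ ?_ (norm_nonneg _) ?_)
    · rw [Tate.norm_const]
      exact norm_ofA_C_le _
    · exact (norm_pow_le _ _).trans (pow_le_one₀ (norm_nonneg _) (Tate.norm_ofPoly_X_le j))
  have h3 : ofK F (algebraMap F[X] (RatFunc F) a)⁻¹ = (ofA F a)⁻¹ := map_inv₀ _ _
  rw [twistedTerm, map_mul, map_prod, Tate.ofKPoly_C, h3]
  refine (norm_mul_le _ _).trans ?_
  rw [Tate.norm_const, norm_inv, norm_ofA_of_monic ha, inv_pow]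
  refine mul_le_of_le_one_right (inv_nonneg.2 (pow_nonneg (norm_nonneg _) _)) ?_
  refine (Finset.norm_prod_le _ _).trans (Finset.prod_le_one (fun _ _ => norm_nonneg _)
    fun j _ => h1 j)

theorem norm_powerSum_le (d : ℕ) :
    ‖Tate.ofKPoly F s (powerSum F s 1 d)‖ ≤ (‖theta F‖⁻¹) ^ d := by
  rw [powerSum_one, map_sum]
  refine IsUltrametricDist.norm_sum_le_of_forall_le_of_nonneg
    (pow_nonneg (inv_nonneg.2 (norm_nonneg _)) _) fun a ha => ?_
  obtain ⟨h1, h2⟩ := (mem_monics F).1 ha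
  rw [← h2]
  exact norm_twistedTerm_le h1

theorem summable_powerSum :
    Summable fun d => Tate.ofKPoly F s (powerSum F s 1 d) :=
  Summable.of_norm_bounded summable_pow_inv_norm_theta norm_powerSum_le

theorem powerSum_zero : powerSum F s 1 0 = 1 := by
  rw [powerSum_one, sum_monics]
  simp [ofCoeffs_apply, twistedTerm]

theorem tendsto_harmonicSum : Tendsto (fun d => Tate.ofKPoly F s (harmonicSum F s 1 d)) atTop
    (𝓝 (∑' d, Tate.ofKPoly F s (powerSum F s 1 d))) := by
  simp only [harmonicSum, map_sum]
  exact summable_powerSum.hasSum.tendsto_sum_nat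

/-- S_0 = 1, while all later terms have norm at most |θ|⁻¹ < 1 and cannot cancel it. -/
theorem tsum_powerSum_ne_zero : ∑' d, Tate.ofKPoly F s (powerSum F s 1 d) ≠ 0 := by
  rw [(summable_powerSum (F := F) (s := s)).tsum_eq_zero_add, powerSum_zero, map_one]
  intro h
  have h1 : ‖∑' d, Tate.ofKPoly F s (powerSum F s 1 (d + 1))‖ ≤ ‖theta F‖⁻¹ := by
    refine IsUltrametricDist.norm_tsum_le_of_forall_le fun d => (norm_powerSum_le _).trans ?_
    exact pow_le_of_le_one (inv_nonneg.2 (norm_nonneg _))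
      (inv_le_one_of_one_le₀ one_lt_norm_theta.le) (Nat.succ_ne_zero d)
  rw [eq_neg_of_add_eq_zero_right h, norm_neg, norm_one] at h1
  exact absurd h1 (not_le.2 (inv_lt_one_of_one_lt₀ one_lt_norm_theta))

end

section

variable {F : Type*} [Field F] [Fintype F] {s : ℕ}

/-! ### The limits of the harmonic sums and of their remainders -/

variable (F s) in
/-- `θ^(q^n)`. -/
def thetaTwist (n : ℕ) : Tate F s := Tate.const F s (theta F ^ (Fintype.card F ^ n))

variable (F s) in
/-- `θ^(-q^n)`. -/
def thetaTwistInv (n : ℕ) : Tate F s := Tate.const F s (theta F ^ (Fintype.card F ^ n))⁻¹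

theorem thetaTwist_mul_inv (n : ℕ) : thetaTwist F s n * thetaTwistInv F s n = 1 := by
  rw [thetaTwist, thetaTwistInv, ← map_mul, mul_inv_cancel₀ (pow_ne_zero _ theta_ne_zero), map_one]

theorem isUnit_thetaTwist (n : ℕ) : IsUnit (thetaTwist F s n) :=
  IsUnit.of_mul_eq_one _ (thetaTwist_mul_inv n)

theorem tendsto_thetaTwistInv : Tendsto (thetaTwistInv F s) atTop (𝓝 0) :=
  squeeze_zero_norm (fun n => by
    rw [thetaTwistInv, Tate.norm_const, norm_inv, norm_pow]
    exact le_rfl) (summable_thetaDecay (F := F)).tendsto_atTop_zero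

theorem tendsto_periodFactorPartial (m : ℕ) :
    Tendsto (periodFactorPartial F s m) atTop (𝓝 (periodFactor F s m)) := by
  have h1 : Tendsto (fun n => ∏ i ∈ Finset.range (n + m - 1), (1 - periodTerm F i)) atTop
      (𝓝 (periodProd F)) :=
    (multipliable_one_sub summable_norm_periodTerm).tendsto_prod_tprod_nat.comp
      (tendsto_atTop_mono (fun n => by omega : ∀ n, n - 1 ≤ n + m - 1) (tendsto_sub_atTop_nat 1))
  have h2 : ∀ j : Fin s, Tendsto (fun n => ∏ i ∈ Finset.range n, (1 - (omegaTerm j i : Tate F s)))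
      atTop (𝓝 (omegaProd j)) := fun j =>
    (multipliable_one_sub (summable_norm_omegaTerm j)).tendsto_prod_tprod_nat
  exact ((Tate.continuous_const.tendsto _).comp
    ((h1.inv₀ periodProd_ne_zero).const_mul _)).mul (tendsto_finsetProd _ fun j _ => h2 j)

/-- The tail of each product in t_j contributes -t_j, and the tail belonging to π̃ contributes
nothing at this order. -/
theorem tendsto_thetaTwist_mul_tail {m : ℕ} (hm : 2 ≤ m) :
    Tendsto (fun n => thetaTwist F s n * (periodFactorTail F s m n - 1)) atTop
      (𝓝 (-∑ j : Fin s, Tate.ofPoly F s (MvPolynomial.X j))) := by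
  have hr1 : ∀ n, thetaDecay F n ≤ 1 := fun n => (thetaDecay_lt_one n).le
  have hT : ∀ j : Fin s, Tendsto (fun n => ∏' i, (1 - (omegaTerm j (i + n) : Tate F s))) atTop
      (𝓝 1) := fun j => tendsto_tprod_tail thetaDecay_antitone thetaDecay_nonneg hr1
        summable_thetaDecay (norm_omegaTerm_le j)
  have hTy : ∀ j : Fin s, Tendsto
      (fun n => thetaTwist F s n * (∏' i, (1 - (omegaTerm j (i + n) : Tate F s)) - 1)) atTop
      (𝓝 (-Tate.ofPoly F s (MvPolynomial.X j))) := fun j =>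
    tendsto_mul_tprod_tail_sub_one thetaDecay_antitone thetaDecay_nonneg hr1
      summable_thetaDecay (norm_omegaTerm_le j)
      (fun n => by
        have h : (omegaTerm j n : Tate F s) =
          Tate.ofPoly F s (MvPolynomial.X j) * thetaTwistInv F s n := rfl
        rw [h, mul_left_comm, thetaTwist_mul_inv, mul_one])
      (by
        simp only [thetaTwist, Tate.norm_const]
        exact tendsto_norm_theta_pow_mul_thetaDecay)
  have hsub : Tendsto (fun n => n + m - 1) atTop atTop :=
    tendsto_atTop_mono (fun n => by omega : ∀ n, n - 1 ≤ n + m - 1) (tendsto_sub_atTop_nat 1)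
  have hV : Tendsto (fun n => ∏' i, (1 - periodTerm F (i + (n + m - 1)))) atTop (𝓝 1) :=
    (tendsto_tprod_tail thetaDecay_antitone thetaDecay_nonneg hr1
      summable_thetaDecay norm_periodTerm_le).comp hsub
  have hVi : Tendsto (fun n => (∏' i, (1 - periodTerm F (i + (n + m - 1))))⁻¹) atTop (𝓝 1) := by
    simpa using hV.inv₀ one_ne_zero
  have hVy : Tendsto (fun n => theta F ^ (Fintype.card F ^ n) *
      (∏' i, (1 - periodTerm F (i + (n + m - 1))) - 1)) atTop (𝓝 0) := by
    refine squeeze_zero_norm (fun n => ?_) (tendsto_norm_theta_pow_mul_thetaDecay (F := F))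
    rw [norm_mul]
    refine mul_le_mul_of_nonneg_left ?_ (norm_nonneg _)
    -- The tail starts at n + m - 1 ≥ n + 1, where its distance to 1 is at most |θ|^(-q^(n+1)); this
    -- uses `2 ≤ m`.
    exact (norm_tprod_tail_sub_one_le thetaDecay_antitone thetaDecay_nonneg hr1
      summable_thetaDecay norm_periodTerm_le _).trans (thetaDecay_antitone (by omega))
  have hVne : ∀ n, ∏' i, (1 - periodTerm F (i + (n + m - 1))) ≠ 0 := fun n h0 =>
    periodProd_ne_zero (F := F) (by
      rw [periodProd, ← prod_mul_tprod_tail summable_thetaDecay norm_periodTerm_le (n + m - 1), h0,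
        mul_zero])
  have hViy : Tendsto (fun n => thetaTwist F s n * (Tate.const F s
      (∏' i, (1 - periodTerm F (i + (n + m - 1))))⁻¹ - 1)) atTop (𝓝 0) := by
    have h := (Tate.continuous_const (F := F) (s := s)).tendsto _ |>.comp (hVy.mul hVi).neg
    rw [zero_mul, neg_zero, map_zero] at h
    refine h.congr fun n => ?_
    rw [Function.comp_apply, thetaTwist, ← map_one (Tate.const F s), ← map_sub, ← map_mul]
    congr 1
    field_simp [hVne n]
    ring
  have h := tendsto_mul_mul_sub_one (tendsto_mul_prod_sub_one Finset.univ hTy hT)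
    (((Tate.continuous_const (F := F) (s := s)).tendsto 1).comp hVi |>.trans (by rw [map_one]))
    hViy
  rw [add_zero, Finset.sum_neg_distrib] at h
  exact h

/-- `H(θ^(q^n)) / θ^(q^n deg H)`. -/
def normalizedEval (H : Polynomial (MvPolynomial (Fin s) F[X])) (n : ℕ) : Tate F s :=
  (H.reverse.map (Tate.ofAPoly F s)).eval (thetaTwistInv F s n)

theorem normalizedEval_mul (H : Polynomial (MvPolynomial (Fin s) F[X])) (n : ℕ) :
    normalizedEval H n * thetaTwist F s n ^ H.natDegree =
      Tate.ofAPoly F s (H.eval (MvPolynomial.C (X ^ (Fintype.card F ^ n)))) := by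
  let _ : Invertible (thetaTwist F s n) := ⟨thetaTwistInv F s n,
    by rw [mul_comm, thetaTwist_mul_inv], thetaTwist_mul_inv n⟩
  have h1 : Tate.ofAPoly F s (MvPolynomial.C (X ^ (Fintype.card F ^ n))) = thetaTwist F s n := by
    rw [Tate.ofAPoly_C, map_pow, ofA_X, thetaTwist]
  rw [← eval₂_at_apply, h1, ← eval₂_reverse_mul_pow, normalizedEval, eval_map]
  rfl

theorem tendsto_normalizedEval (H : Polynomial (MvPolynomial (Fin s) F[X])) :
    Tendsto (normalizedEval H) atTop (𝓝 (Tate.ofAPoly F s H.leadingCoeff)) := by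
  have h := ((H.reverse.map (Tate.ofAPoly F s)).continuous.tendsto 0).comp tendsto_thetaTwistInv
  rw [← coeff_zero_eq_eval_zero, coeff_map, coeff_zero_reverse] at h
  exact h

/-- A difference quotient at 0 of the reversed polynomial along θ^(-q^n) → 0; its limit is the
linear coefficient of the reversal. -/
theorem tendsto_thetaTwist_mul_normalizedEval_sub (H : Polynomial (MvPolynomial (Fin s) F[X]))
    (hH : H.natDegree ≠ 0) :
    Tendsto (fun n => thetaTwist F s n * (normalizedEval H n - Tate.ofAPoly F s H.leadingCoeff))
      atTop (𝓝 (Tate.ofAPoly F s (H.coeff (H.natDegree - 1)))) := by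
  have h := ((H.reverse.map (Tate.ofAPoly F s)).divX.continuous.tendsto 0).comp
    tendsto_thetaTwistInv
  rw [← coeff_zero_eq_eval_zero, coeff_divX, coeff_map, zero_add, coeff_reverse,
    revAt_le (Nat.one_le_iff_ne_zero.2 hH)] at h
  refine h.congr fun n => ?_
  have h1 := congrArg (eval (thetaTwistInv F s n))
    (X_mul_divX_add (H.reverse.map (Tate.ofAPoly F s)))
  rw [eval_add, eval_mul, eval_X, eval_C, coeff_map, coeff_zero_reverse] at h1
  rw [normalizedEval, ← h1, add_sub_cancel_right, ← mul_assoc, thetaTwist_mul_inv, one_mul]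
  rfl

/-! ### Degree, leading coefficient and subleading coefficient of H -/

section Main

variable {m : ℕ} (hs : s = (Fintype.card F - 1) * m + 1) (hm : 2 ≤ m) (hmi : mIndex F s = m)
  {H : Polynomial (MvPolynomial (Fin s) F[X])} (hH : Interpolates H)

include hs hm hmi hH

theorem Interpolates.ofKPoly_mul (n : ℕ) :
    Tate.ofKPoly F s (harmonicSum F s 1 (n + m)) * thetaTwist F s n ^ muIndex F s =
      periodFactorPartial F s m n * (normalizedEval H n * thetaTwist F s n ^ H.natDegree) := by
  have h1 := hH (n + m) (by omega)
  rw [hmi, Nat.add_sub_cancel] at h1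
  rw [h1, normalizedEval_mul, ← ofKPoly_bigPi_mul hs (by omega) hmi, map_mul, Tate.ofAPoly,
    RingHom.comp_apply, thetaTwist]
  ring

/-- Growth comparison: a smaller degree would give ζ = 0, and a larger one would give U · lead(H) =
0 although U is a unit. -/
theorem Interpolates.natDegree_eq : H.natDegree = muIndex F s := by
  have hF := (tendsto_add_atTop_iff_nat m).2 (tendsto_harmonicSum (F := F) (s := s))
  have hζ := tsum_powerSum_ne_zero (F := F) (s := s)
  have hP := (tendsto_periodFactorPartial (F := F) (s := s) m).mul (tendsto_normalizedEval H)
  have key := Interpolates.ofKPoly_mul hs hm hmi hH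
  have hpow : ∀ n k, thetaTwist F s n ^ k * thetaTwistInv F s n ^ k = 1 := fun n k => by
    rw [← mul_pow, thetaTwist_mul_inv, one_pow]
  have hZ : ∀ {k : ℕ}, k ≠ 0 → Tendsto (fun n => thetaTwistInv F s n ^ k) atTop (𝓝 0) :=
    fun {k} hk => by
      have := (tendsto_thetaTwistInv (F := F) (s := s)).pow k
      rwa [zero_pow hk] at this
  rcases lt_trichotomy H.natDegree (muIndex F s) with hlt | heq | hgt
  · obtain ⟨k, hk⟩ := Nat.exists_eq_add_of_lt hlt
    refine absurd (tendsto_nhds_unique hF ?_) hζ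
    have h := hP.mul (hZ (Nat.succ_ne_zero k))
    rw [mul_zero] at h
    refine h.congr fun n => ?_
    have h1 := key n
    rw [hk, add_assoc, pow_add, ← mul_assoc _ (normalizedEval H n), mul_left_comm,
      mul_comm (thetaTwist F s n ^ H.natDegree)] at h1
    refine ((isUnit_thetaTwist n).pow H.natDegree).mul_left_cancel ?_
    calc _ = periodFactorPartial F s m n * normalizedEval H n * thetaTwist F s n ^ H.natDegree *
          thetaTwistInv F s n ^ (k + 1) := by rw [Nat.succ_eq_add_one]; ring
      _ = thetaTwist F s n ^ H.natDegree * Tate.ofKPoly F s (harmonicSum F s 1 (n + m)) *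
          (thetaTwist F s n ^ (k + 1) * thetaTwistInv F s n ^ (k + 1)) := by rw [← h1]; ring
      _ = _ := by rw [hpow, mul_one]
  · exact heq
  · obtain ⟨k, hk⟩ := Nat.exists_eq_add_of_lt hgt
    have h0 : periodFactor F s m * Tate.ofAPoly F s H.leadingCoeff = 0 := by
      refine tendsto_nhds_unique hP ?_
      have h := hF.mul (hZ (Nat.succ_ne_zero k))
      rw [mul_zero] at h
      refine h.congr fun n => ?_
      have h1 := key n
      rw [hk, add_assoc, pow_add] at h1
      refine ((isUnit_thetaTwist n).pow (muIndex F s)).mul_left_cancel ?_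
      calc _ = Tate.ofKPoly F s (harmonicSum F s 1 (n + m)) * thetaTwist F s n ^ muIndex F s *
            thetaTwistInv F s n ^ (k + 1) := by rw [Nat.succ_eq_add_one]; ring
        _ = thetaTwist F s n ^ muIndex F s * (periodFactorPartial F s m n * normalizedEval H n) *
            (thetaTwist F s n ^ (k + 1) * thetaTwistInv F s n ^ (k + 1)) := by rw [h1]; ring
        _ = _ := by rw [hpow, mul_one]
    rw [(isUnit_periodFactor m).mul_right_eq_zero,
      map_eq_zero_iff _ Tate.ofAPoly_injective, leadingCoeff_eq_zero] at h0
    rw [h0, natDegree_zero] at hgt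
    omega

theorem Interpolates.ofKPoly_harmonicSum (n : ℕ) :
    Tate.ofKPoly F s (harmonicSum F s 1 (n + m)) =
      periodFactorPartial F s m n * normalizedEval H n := by
  have h := Interpolates.ofKPoly_mul hs hm hmi hH n
  rw [Interpolates.natDegree_eq hs hm hmi hH, ← mul_assoc] at h
  exact ((isUnit_thetaTwist n).pow _).mul_right_cancel h

theorem Interpolates.tsum_powerSum : ∑' d, Tate.ofKPoly F s (powerSum F s 1 d) =
    periodFactor F s m * Tate.ofAPoly F s H.leadingCoeff := by
  refine tendsto_nhds_unique ((tendsto_add_atTop_iff_nat m).2 tendsto_harmonicSum) ?_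
  simp only [Interpolates.ofKPoly_harmonicSum hs hm hmi hH]
  exact (tendsto_periodFactorPartial m).mul (tendsto_normalizedEval H)

/-- With U = U_n T_n (T_n the tail) and F_d = U_n h_n, one has ζ - F_d = U_n ((T_n - 1) lead(H) -
(h_n - lead(H))), and both differences have known limits after scaling by θ^(q^n). -/
theorem Interpolates.tendsto_thetaTwist_mul_remainder :
    Tendsto (fun n => thetaTwist F s n *
        (∑' d, Tate.ofKPoly F s (powerSum F s 1 d) - Tate.ofKPoly F s (harmonicSum F s 1 (n + m))))
      atTop (𝓝 (-(periodFactor F s m * Tate.ofAPoly F s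
        (H.coeff (muIndex F s - 1) + (∑ j, MvPolynomial.X j) * H.leadingCoeff)))) := by
  have hdeg := Interpolates.natDegree_eq hs hm hmi hH
  have hμ : H.natDegree ≠ 0 := by
    have h1 := muIndex_add (F := F) hmi
    have h2 : m < ∑ i ∈ Finset.range m, Fintype.card F ^ i := by
      calc m = ∑ i ∈ Finset.range m, 1 := by simp
        _ < _ := Finset.sum_lt_sum (fun i _ => Nat.pow_pos Fintype.card_pos)
          ⟨1, Finset.mem_range.2 (by omega), by rw [pow_one]; exact Fintype.one_lt_card⟩
    omega
  have h := (tendsto_periodFactorPartial (F := F) (s := s) m).mul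
    (((tendsto_thetaTwist_mul_tail (F := F) (s := s) hm).mul_const
      (Tate.ofAPoly F s H.leadingCoeff)).sub (tendsto_thetaTwist_mul_normalizedEval_sub H hμ))
  have hlim : periodFactor F s m * (-(∑ j : Fin s, Tate.ofPoly F s (MvPolynomial.X j)) *
      Tate.ofAPoly F s H.leadingCoeff - Tate.ofAPoly F s (H.coeff (H.natDegree - 1))) =
      -(periodFactor F s m * Tate.ofAPoly F s
        (H.coeff (muIndex F s - 1) + (∑ j, MvPolynomial.X j) * H.leadingCoeff)) := by
    rw [hdeg, map_add, map_mul, map_sum]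
    simp only [Tate.ofAPoly_X]
    ring
  rw [hlim] at h
  refine h.congr fun n => ?_
  rw [Interpolates.tsum_powerSum hs hm hmi hH, Interpolates.ofKPoly_harmonicSum hs hm hmi hH,
    ← periodFactorPartial_mul_tail m n]
  ring

end Main

theorem eq_card_sub_one_mul_mIndex_add_one (hs : 2 * Fintype.card F - 1 ≤ s)
    (hmod : s ≡ 1 [MOD Fintype.card F - 1]) :
    s = (Fintype.card F - 1) * mIndex F s + 1 ∧ 2 ≤ mIndex F s := by
  have hq := Fintype.one_lt_card (α := F)
  have h1 : Fintype.card F - 1 ∣ s - 1 := (Nat.modEq_iff_dvd' (by omega)).1 hmod.symm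
  refine ⟨?_, ?_⟩
  · rw [mIndex, Nat.mul_div_cancel' h1]
    omega
  · rw [mIndex, Nat.le_div_iff_mul_le (by omega)]
    omega

theorem tsum_powerSum_add (d : ℕ) : ∑' i, Tate.ofKPoly F s (powerSum F s 1 (d + i)) =
    ∑' i, Tate.ofKPoly F s (powerSum F s 1 i) - Tate.ofKPoly F s (harmonicSum F s 1 d) := by
  rw [← (summable_powerSum (F := F) (s := s)).sum_add_tsum_nat_add d, harmonicSum, map_sum,
    add_sub_cancel_left]
  simp only [add_comm]

end

end CarlitzTate

end

open CarlitzTate in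
theorem mainTheorem7 (F : Type*) [Field F] [Fintype F] (s : ℕ)
    (hs : 2 * Fintype.card F - 1 ≤ s) (hmod : s ≡ 1 [MOD Fintype.card F - 1])
    (ϖ : CarlitzTate.CInfty F) (hϖ : ϖ ^ (Fintype.card F - 1) = -CarlitzTate.theta F) :
    (∃! lam : MvPolynomial (Fin s) (Polynomial F), CarlitzTate.IsZetaCoefficient ϖ lam) ∧
    (∃! H : Polynomial (MvPolynomial (Fin s) (Polynomial F)), CarlitzTate.Interpolates H) ∧
    Summable (fun i : ℕ => CarlitzTate.Tate.ofKPoly F s (CarlitzTate.powerSum F s 1 i)) ∧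
    ∃ ν : MvPolynomial (Fin s) (Polynomial F),
      Tendsto (fun d : ℕ =>
          CarlitzTate.Tate.const F s
              (CarlitzTate.theta F ^ (Fintype.card F ^ (d - CarlitzTate.mIndex F s))) *
            ∑' i : ℕ, CarlitzTate.Tate.ofKPoly F s (CarlitzTate.powerSum F s 1 (d + i)))
        atTop (𝓝 (CarlitzTate.periodMultiple ϖ ν)) ∧
      ∀ (lam : MvPolynomial (Fin s) (Polynomial F))
        (H : Polynomial (MvPolynomial (Fin s) (Polynomial F))),
        CarlitzTate.IsZetaCoefficient ϖ lam → CarlitzTate.Interpolates H →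
          H.natDegree = CarlitzTate.muIndex F s ∧
          H.coeff (CarlitzTate.muIndex F s - 1) =
            ν + (∑ j : Fin s, MvPolynomial.X j) * lam := by
  obtain ⟨hsm, hm⟩ := eq_card_sub_one_mul_mIndex_add_one hs hmod
  obtain ⟨H, hH⟩ := exists_interpolates hsm (by omega) rfl
  have hzeta : IsZetaCoefficient ϖ (-H.leadingCoeff) := by
    rw [IsZetaCoefficient, periodMultiple_eq hϖ hsm, map_neg, mul_neg, neg_neg,
      ← Interpolates.tsum_powerSum hsm hm rfl hH]
    exact tendsto_harmonicSum
  have hzeta_unique : ∀ lam, IsZetaCoefficient ϖ lam → lam = -H.leadingCoeff := by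
    intro lam hlam
    have h := tendsto_nhds_unique hlam hzeta
    rw [periodMultiple_eq hϖ hsm, periodMultiple_eq hϖ hsm, neg_inj] at h
    exact Tate.ofAPoly_injective ((isUnit_periodFactor _).mul_left_cancel h)
  -- The witness for ν is read off from the limit of the remainders; since lead(H) = -λ, it
  -- rearranges to the stated formula.
  refine ⟨⟨_, hzeta, hzeta_unique⟩, ⟨H, hH, fun H' hH' => hH'.unique hH⟩, summable_powerSum,
    H.coeff (muIndex F s - 1) + (∑ j, MvPolynomial.X j) * H.leadingCoeff, ?_, ?_⟩
  · rw [periodMultiple_eq hϖ hsm, ← tendsto_add_atTop_iff_nat (mIndex F s)]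
    refine (Interpolates.tendsto_thetaTwist_mul_remainder hsm hm rfl hH).congr fun n => ?_
    rw [tsum_powerSum_add, Nat.add_sub_cancel, thetaTwist]
  · intro lam H' hlam hH'
    obtain rfl := hH'.unique hH
    rw [hzeta_unique lam hlam]
    exact ⟨Interpolates.natDegree_eq hsm hm rfl hH, by ring⟩
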